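/- Let $\mathcal F\subseteq[m]\times[n]$ be an $m\times n$ Ferrers diagram, i.e. a set of dots that is right aligned ($(i,j)\in\mathcal F$, $j<n$ imply $(i,j+1)\in\mathcal F$) and top aligned ($(i,j)\in\mathcal F$, $i>1$ imply $(i-1,j)\in\mathcal F$), and let $t=|\mathcal F|$. For a field $K$ let $K[\mathcal F]$ be the space of matrices in $K^{m\times n}$ whose nonzero entries all lie at positions in $\mathcal F$. The rank distance of a subspace $\mathcal C\subseteq K^{m\times n}$ is the minimum rank of a nonzero element of $\mathcal C$ ($+\infty$ if $\mathcal C=0$). An $[\mathcal F,N;\delta]$-code (respectively $[\mathcal F,N;\ge\delta]$-code) over $K$ is an $N$-dimensional subspace of $K[\mathcal F]$ with rank distance exactly $\delta$ (respectively at least $\delta$). For $0\le j\le\delta-1$ let $\nu_j$ be the number of dots of $\mathcal F$ that remain after removing the top $j$ rows and the rightmost $\delta-1-j$ columns, and put $\nu_{\min}=\nu_{\min}(\mathcal F;\delta)=\min\{\nu_0,\dots,\nu_{\delta-1}\}$. A maximal $[\mathcal F;\delta]$-code is an $[\mathcal F,\nu_{\min};\delta]$-code. Maximal $[\mathcal F;\delta]$-codes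 are called generic if the proportion of maximal $[\mathcal F;\delta]$-codes over $\mathbb F_q$ among all $\nu_{\min}$-dimensional subspaces of $\mathbb F_q[\mathcal F]$ tends to $1$ as $q\to\infty$ through all prime powers. **Theorem.** Let $1\le\delta\le n$ and suppose $\nu_{\min}(\mathcal F;\delta)>0$. Let $q$ be a prime power and let $\overline{\mathbb F}$ be an algebraic closure of $\mathbb F_q$. (a) For every integer $N$ with $0\le N\le\nu_{\min}(\mathcal F;\delta)$ the following are equivalent: (i) there exist $A_1,\dots,A_N\in\overline{\mathbb F}[\mathcal F]$ whose span is an $[\mathcal F,N;\ge\delta]$-code; (ii) the set of all $(A_1,\dots,A_N)\in\overline{\mathbb F}[\mathcal F]^N=\overline{\mathbb F}^{Nt}$ whose span is an $[\mathcal F,N;\ge\delta]$-code is a nonempty Zariski-open subset of $\overline{\mathbb F}^{Nt}$; (iii) the probability that $N$ matrices chosen independently and uniformly at random from $\mathbb F_{q^r}[\mathcal F]$ span an $[\mathcal F,N;\ge\delta]$-code over $\mathbb F_{q^r}$ tends to $1$ as $r\to\infty$. (b) For $N=\nu_{\min}(\mathcal F;\delta)$ the statements (i), (ii), (iii) with "$[\mathcal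 F,N;\delta]$-code" (rank distance exactly $\delta$) in place of "$[\mathcal F,N;\ge\delta]$-code" are also equivalent. (c) Maximal $[\mathcal F;\delta]$-codes are generic if and only if for every algebraically closed field $K$ of positive characteristic there exists a maximal $[\mathcal F;\delta]$-code over $K$. -/

import Mathlib

open Filter Topology

/-- An `m × n` Ferrers diagram: a right aligned and top aligned set of dots in the `m × n` grid.
Rows are indexed from top to bottom and columns from left to right (both starting at `0`). -/
structure FerrersDiagram (m n : ℕ) where
  dots : Finset (Fin m × Fin n)
  right_aligned : ∀ (i : Fin m) (j j' : Fin n), j ≤ j' → (i, j) ∈ dots → (i, j') ∈ dots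
  top_aligned : ∀ (i i' : Fin m) (j : Fin n), i' ≤ i → (i, j) ∈ dots → (i', j) ∈ dots

namespace FerrersDiagram

variable {m n : ℕ}

/-- The number of dots left after removing the top `j` rows and the rightmost `δ - 1 - j` columns
(used for `j ≤ δ - 1`). -/
def nu (F : FerrersDiagram m n) (δ j : ℕ) : ℕ :=
  (F.dots.filter fun x => j ≤ x.1.val ∧ x.2.val + (δ - 1 - j) < n).card

/-- The minimum of `ν_0, …, ν_{δ-1}` (used for `δ ≥ 1`). -/
noncomputable def nuMin (F : FerrersDiagram m n) (δ : ℕ) : ℕ :=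
  ⨅ j : Fin δ, F.nu δ j

/-- The space of all matrices with shape `F`. -/
def shapeSpace (F : FerrersDiagram m n) (K : Type*) [Field K] :
    Submodule K (Matrix (Fin m) (Fin n) K) where
  carrier := {M | ∀ i j, M i j ≠ 0 → (i, j) ∈ F.dots}
  zero_mem' := fun _ _ h => absurd rfl h
  add_mem' := by
    intro A B hA hB i j h
    by_contra hn
    have h1 : A i j = 0 := by
      by_contra h2
      exact hn (hA i j h2)
    have h3 : B i j = 0 := by
      by_contra h2
      exact hn (hB i j h2)
    exact h (by simp [h1, h3])
  smul_mem' := by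
    intro c A hA i j h
    refine hA i j fun h0 => h ?_
    simp [h0]

/-- The matrix with shape `F` whose entries at the positions in `F` are given by `x`. -/
def shapeMatrix (F : FerrersDiagram m n) {K : Type*} [Field K] (x : F.dots → K) :
    Matrix (Fin m) (Fin n) K :=
  Matrix.of fun i j => if h : (i, j) ∈ F.dots then x ⟨(i, j), h⟩ else 0

end FerrersDiagram

/-- The rank distance of a rank-metric code: the least rank of a nonzero element
(`⊤` for the zero code). -/
noncomputable def rankDist {m n : ℕ} {K : Type*} [Field K]
    (C : Submodule K (Matrix (Fin m) (Fin n) K)) : ℕ∞ :=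
  ⨅ M : {M : Matrix (Fin m) (Fin n) K // M ∈ C ∧ M ≠ 0}, (M.1.rank : ℕ∞)

namespace FerrersDiagram

variable {m n : ℕ}

/-- `C` is a `k`-dimensional code of shape `F` with rank distance exactly `δ`. -/
def IsCode (F : FerrersDiagram m n) (k δ : ℕ) {K : Type*} [Field K]
    (C : Submodule K (Matrix (Fin m) (Fin n) K)) : Prop :=
  C ≤ F.shapeSpace K ∧ Module.finrank K C = k ∧ rankDist C = δ

/-- `C` is a `k`-dimensional code of shape `F` with rank distance at least `δ`. -/
def IsCodeAtLeast (F : FerrersDiagram m n) (k δ : ℕ) {K : Type*} [Field K]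
    (C : Submodule K (Matrix (Fin m) (Fin n) K)) : Prop :=
  C ≤ F.shapeSpace K ∧ Module.finrank K C = k ∧ (δ : ℕ∞) ≤ rankDist C

/-- A maximal code: a code with rank distance `δ` and dimension `nuMin`. -/
def IsMaximalCode (F : FerrersDiagram m n) (δ : ℕ) {K : Type*} [Field K]
    (C : Submodule K (Matrix (Fin m) (Fin n) K)) : Prop :=
  F.IsCode (F.nuMin δ) δ C

/-- The probability, over a finite field `K`, that the span of `N` independent and uniformly
distributed matrices with shape `F` has the property `P`. -/
noncomputable def spanProb (F : FerrersDiagram m n) (N : ℕ) (K : Type*) [Field K]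
    (P : Submodule K (Matrix (Fin m) (Fin n) K) → Prop) : ℝ :=
  (Nat.card {A : Fin N → F.shapeSpace K //
      P (Submodule.span K (Set.range fun k => (A k : Matrix (Fin m) (Fin n) K)))} : ℝ) /
    (Nat.card (Fin N → F.shapeSpace K) : ℝ)

/-- The points `(A_1, …, A_N)` of the affine space `K ^ (N t)`, with `t` the number of dots of `F`,
such that the span of the matrices `A_1, …, A_N` with shape `F` has the property `P`. -/
def spanLocus (F : FerrersDiagram m n) (N : ℕ) (K : Type*) [Field K]
    (P : Submodule K (Matrix (Fin m) (Fin n) K) → Prop) : Set (Fin N × F.dots → K) :=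
  {a | P (Submodule.span K (Set.range fun k => F.shapeMatrix fun x => a (k, x)))}

/-- The proportion of maximal codes among all `nuMin`-dimensional subspaces of the space of
matrices with shape `F` over the finite field `K`. -/
noncomputable def maximalProportion (F : FerrersDiagram m n) (δ : ℕ) (K : Type*) [Field K] : ℝ :=
  (Nat.card {C : Submodule K (Matrix (Fin m) (Fin n) K) // F.IsMaximalCode δ C} : ℝ) /
    (Nat.card {C : Submodule K (Matrix (Fin m) (Fin n) K) //
      C ≤ F.shapeSpace K ∧ Module.finrank K C = F.nuMin δ} : ℝ)

/-- Maximal codes are generic: their proportion over the field with `q` elements tends to `1` as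
`q` tends to infinity through all prime powers `q = p ^ e`. -/
def MaximalCodesGeneric (F : FerrersDiagram m n) (δ : ℕ) : Prop :=
  Tendsto
    (fun x : Nat.Primes × ℕ+ =>
      haveI : Fact (x.1 : ℕ).Prime := ⟨x.1.2⟩
      F.maximalProportion δ (GaloisField (x.1 : ℕ) (x.2 : ℕ)))
    (comap (fun x : Nat.Primes × ℕ+ => (x.1 : ℕ) ^ (x.2 : ℕ)) atTop) (𝓝 1)

end FerrersDiagram

/-- Zariski-open subsets of affine space: complements of zero loci of polynomial ideals. -/
def IsZariskiOpen {σ K : Type*} [Field K] (U : Set (σ → K)) : Prop :=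
  ∃ I : Ideal (MvPolynomial σ K), U = (MvPolynomial.zeroLocus K I)ᶜ

/-! Put `r = δ - 1` and let `rankDim r` be the sum, over the diagonals of `F`, of the number of dots
capped at `r`. Statements (i), (ii), (iii) are each equivalent to the inequality `N + rankDim r ≤
t`, in which no field occurs.

Over the field with `q` elements, the matrices of shape `F` and rank at most `r` number between `q ^
rankDim r` and `2 ^ m * q ^ rankDim r` (`le_lowRankCard`, `lowRankCard_le`); the proof peels off the
top row. A tuple fails to span a code exactly when some nontrivial combination of it has rank at
most `r`. If the inequality holds, the expected number of such combinations up to scalars is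
`O(1/q)` (`le_spanProb`), and over any infinite field Reed-Solomon codes on the diagonals give an
explicit code (`exists_code`). If it fails, a second moment estimate shows that at least a third of
all tuples fail, over every finite field (`spanProb_le`).

Over an algebraically closed field the good tuples form an open set, by elimination theory applied
to the `δ`-minors (`isZariskiOpen_spanLocus`). If this set is nonempty in characteristic `p`,
Schwartz-Zippel gives success probability at least `1 - D / q` over the finite fields of
characteristic `p`, with `D` fixed; this contradicts the bound `2 / 3` unless the inequality holds
(`add_rankDim_le_of_exists`).

For (b), the Singleton-type bound drops strictly from `δ` to `δ + 1`, so at dimension `nuMin`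
distance at least `δ` means exactly `δ` (`isCode_nuMin_iff`). For (c), all subspaces of a given
dimension have equally many ordered bases, so the proportion of maximal codes is a quotient of two
tuple probabilities (`maximalProportion_eq`). -/

/-! ### Spans of tuples and the Singleton-type bound. -/

theorem Matrix.rank_add_le_add {m n : Type*} [Fintype m] [Fintype n] {K : Type*} [Field K]
    (A B : Matrix m n K) : (A + B).rank ≤ A.rank + B.rank := by
  unfold Matrix.rank
  rw [Matrix.mulVecLin_add]
  refine (Submodule.finrank_mono (LinearMap.range_add_le _ _)).trans ?_
  exact Submodule.finrank_add_le_finrank_add_finrank _ _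

theorem le_rankDist_iff {m n : ℕ} {K : Type*} [Field K]
    (C : Submodule K (Matrix (Fin m) (Fin n) K)) (δ : ℕ) :
    (δ : ℕ∞) ≤ rankDist C ↔ ∀ M ∈ C, M ≠ 0 → δ ≤ M.rank := by
  simp [rankDist, le_iInf_iff]

namespace FerrersDiagram

variable {m n : ℕ}

/-- Since `δ ≥ 1`, the rank condition already excludes a vanishing nontrivial combination, so it
encodes dimension and distance at once. Counting and elimination both start from this form. -/
theorem isCodeAtLeast_span_iff (F : FerrersDiagram m n) {N δ : ℕ} (hδ : 1 ≤ δ)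
    {K : Type*} [Field K] (A : Fin N → Matrix (Fin m) (Fin n) K)
    (hA : ∀ k, A k ∈ F.shapeSpace K) :
    F.IsCodeAtLeast N δ (Submodule.span K (Set.range A)) ↔
      ∀ x : Fin N → K, x ≠ 0 → δ ≤ (∑ k, x k • A k).rank := by
  have hsub : Submodule.span K (Set.range A) ≤ F.shapeSpace K := by
    rw [Submodule.span_le]; rintro _ ⟨k, rfl⟩; exact hA k
  constructor
  · rintro ⟨-, h2, h3⟩ x hx
    rw [le_rankDist_iff] at h3
    refine h3 _ (Submodule.sum_mem _ fun k _ => Submodule.smul_mem _ _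
      (Submodule.subset_span ⟨k, rfl⟩)) fun h0 => hx ?_
    have hli : LinearIndependent K A := by
      rw [linearIndependent_iff_card_eq_finrank_span, Fintype.card_fin]
      exact h2.symm
    exact funext (Fintype.linearIndependent_iff.1 hli x h0)
  · intro h
    have hli : LinearIndependent K A := by
      rw [Fintype.linearIndependent_iff]
      intro x hx
      by_contra! hne
      have := h x (fun h0 => by obtain ⟨i, hi⟩ := hne; exact hi (congrFun h0 i))
      rw [hx, Matrix.rank_zero] at this
      omega
    refine ⟨hsub, by rw [finrank_span_eq_card hli, Fintype.card_fin], ?_⟩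
    rw [le_rankDist_iff]
    intro M hM hM0
    obtain ⟨x, rfl⟩ := (Submodule.mem_span_range_iff_exists_fun K).1 hM
    exact h x fun h0 => hM0 (by simp [h0])

/-- Split `M` into its top `j` rows and the rest, which lives in the last `l` columns. -/
theorem rank_le_of_support {K : Type*} [Field K] (M : Matrix (Fin m) (Fin n) K) (j l : ℕ)
    (h : ∀ a b, j ≤ a.val → b.val + l < n → M a b = 0) : M.rank ≤ j + l := by
  classical
  let P : Matrix (Fin m) (Fin n) K := Matrix.of fun a b => if a.val < j then M a b else 0
  let Q : Matrix (Fin m) (Fin n) K := Matrix.of fun a b => if a.val < j then 0 else M a b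
  have hPQ : M = P + Q := by
    ext a b; simp only [P, Q, Matrix.add_apply, Matrix.of_apply]; split_ifs <;> simp
  have hP : P.rank ≤ j := by
    refine (Matrix.rank_le_card_of_support_subset P
      (Finset.univ.filter fun a : Fin m => a.val < j) ?_).trans ?_
    · intro a ha
      by_contra hn
      apply ha
      ext b
      simp only [Finset.coe_filter, Finset.mem_univ, true_and, Set.mem_ofPred_eq] at hn
      simp [P, Matrix.of_apply, hn]
    · calc _ ≤ (Finset.range j).card := Finset.card_le_card_of_injOn Fin.val
            (by intro a ha; simpa using ha) Fin.val_injective.injOn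
        _ = j := Finset.card_range j
  have hQ : Q.rank ≤ l := by
    rw [← Matrix.rank_transpose]
    refine (Matrix.rank_le_card_of_support_subset Q.transpose
      (Finset.univ.filter fun b : Fin n => n ≤ b.val + l) ?_).trans ?_
    · intro b hb
      by_contra hn
      apply hb
      ext a
      simp only [Finset.coe_filter, Finset.mem_univ, true_and, Set.mem_ofPred_eq, not_le] at hn
      change Q a b = 0
      simp only [Q, Matrix.of_apply]
      by_cases ha : a.val < j
      · simp [ha]
      · simpa [ha] using h a b (by omega) hn
    · calc _ ≤ (Finset.Ico (n - l) n).card := Finset.card_le_card_of_injOn Fin.val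
            (by intro a ha; simp at ha ⊢; omega) Fin.val_injective.injOn
        _ ≤ l := by rw [Nat.card_Ico]; omega
  calc M.rank ≤ P.rank + Q.rank := by rw [hPQ]; exact Matrix.rank_add_le_add _ _
    _ ≤ j + l := by omega

/-- The Singleton-type bound for codes of shape `F`. -/
theorem finrank_le_nu (F : FerrersDiagram m n) {K : Type*} [Field K]
    (C : Submodule K (Matrix (Fin m) (Fin n) K)) (hC : C ≤ F.shapeSpace K) {δ j : ℕ} (hj : j < δ)
    (h : (δ : ℕ∞) ≤ rankDist C) : Module.finrank K C ≤ F.nu δ j := by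
  classical
  rw [le_rankDist_iff] at h
  let S := F.dots.filter fun x => j ≤ x.1.val ∧ x.2.val + (δ - 1 - j) < n
  let φ : C →ₗ[K] (S → K) :=
    { toFun := fun M x => M.1 x.1.1 x.1.2
      map_add' := fun _ _ => rfl
      map_smul' := fun _ _ => rfl }
  -- A codeword in the kernel is covered by `j` rows and `δ - 1 - j` columns, so its rank is below
  -- `δ`.
  have hφ : Function.Injective φ := by
    rw [← LinearMap.ker_eq_bot, LinearMap.ker_eq_bot']
    rintro ⟨M, hM⟩ h0
    by_contra hne
    have h1 := h M hM (fun h => hne (Subtype.ext h))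
    have h2 : M.rank ≤ j + (δ - 1 - j) := by
      refine rank_le_of_support M _ _ fun a b ha hb => ?_
      by_contra hab
      exact hab (congrFun h0 ⟨(a, b), by simp [S, hC hM a b hab, ha, hb]⟩)
    omega
  calc Module.finrank K C ≤ Module.finrank K (S → K) := LinearMap.finrank_le_finrank_of_injective hφ
    _ = F.nu δ j := by
      rw [Module.finrank_fintype_fun_eq_card, Fintype.card_coe]
      rfl

/-- Passing to `δ + 1` removes one more column, namely the last one still present; right alignment
moves any surviving dot into it, so at least one dot is lost. -/
theorem nu_succ_lt (F : FerrersDiagram m n) {δ j : ℕ} (hj : j < δ) (h : 0 < F.nu δ j) :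
    F.nu (δ + 1) j < F.nu δ j := by
  classical
  obtain ⟨⟨a, b⟩, hab⟩ := Finset.card_pos.1 h
  simp only [Finset.mem_filter] at hab
  refine Finset.card_lt_card ⟨fun x hx => ?_, fun hsub => ?_⟩
  · simp only [Finset.mem_filter] at hx ⊢
    exact ⟨hx.1, hx.2.1, by omega⟩
  · have hc : n - 1 - (δ - 1 - j) < n := by omega
    have := @hsub (a, ⟨n - 1 - (δ - 1 - j), hc⟩) (by
      simp only [Finset.mem_filter]
      exact ⟨F.right_aligned a b _ (by rw [Fin.le_def]; simp only; omega) hab.1, hab.2.1, by omega⟩)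
    simp only [Finset.mem_filter] at this
    omega

/-- A larger distance would bring in the Singleton-type bound for `δ + 1`, which at the minimizing
`j` is strictly smaller than `nuMin`. -/
theorem isCode_nuMin_iff (F : FerrersDiagram m n) {δ : ℕ} (hδ : 1 ≤ δ) (hν : 0 < F.nuMin δ)
    {K : Type*} [Field K] (C : Submodule K (Matrix (Fin m) (Fin n) K)) :
    F.IsCode (F.nuMin δ) δ C ↔ F.IsCodeAtLeast (F.nuMin δ) δ C := by
  refine ⟨fun h => ⟨h.1, h.2.1, h.2.2.ge⟩, fun h => ⟨h.1, h.2.1, ?_⟩⟩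
  refine le_antisymm ?_ h.2.2
  by_contra! hlt
  have : Nonempty (Fin δ) := ⟨⟨0, hδ⟩⟩
  obtain ⟨j, hj⟩ := exists_eq_ciInf_of_finite (f := fun j : Fin δ => F.nu δ j)
  have hj' : F.nu δ j = F.nuMin δ := hj
  have h1 : ((δ + 1 : ℕ) : ℕ∞) ≤ rankDist C := by
    push_cast
    exact Order.add_one_le_of_lt hlt
  have h2 := F.finrank_le_nu C h.1 (j := j) (by omega) h1
  have h3 := F.nu_succ_lt j.2 (by omega)
  rw [h.2.1] at h2
  omega

theorem isCode_nuMin_eq (F : FerrersDiagram m n) {δ : ℕ} (hδ : 1 ≤ δ) (hν : 0 < F.nuMin δ)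
    (K : Type*) [Field K] :
    F.IsCode (K := K) (F.nuMin δ) δ = F.IsCodeAtLeast (F.nuMin δ) δ :=
  funext fun C => propext (F.isCode_nuMin_iff hδ hν C)

theorem nuMin_le_card (F : FerrersDiagram m n) {δ : ℕ} (hδ : 1 ≤ δ) : F.nuMin δ ≤ F.dots.card :=
  (ciInf_le (OrderBot.bddBelow _) (⟨0, hδ⟩ : Fin δ)).trans (Finset.card_filter_le _ _)

end FerrersDiagram

/-! ### Combinatorics of the diagonals of a Ferrers diagram. -/

namespace FerrersDiagram

variable {m n : ℕ}

/-- The number of dots on the `d`-th diagonal, counted from the top right corner. -/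
def diagCard (F : FerrersDiagram m n) (d : ℕ) : ℕ :=
  (F.dots.filter fun x => x.1.val + (n - 1 - x.2.val) = d).card

/-- The largest dimension of a family of matrices of shape `F` and rank at most `r`. -/
def rankDim (F : FerrersDiagram m n) (r : ℕ) : ℕ :=
  ∑ d ∈ Finset.range (m + n), min (F.diagCard d) r

/-- The Ferrers diagram without its top row. -/
def dropRow (F : FerrersDiagram (m + 1) n) : FerrersDiagram m n where
  dots := Finset.univ.filter fun x => (x.1.succ, x.2) ∈ F.dots
  right_aligned i j j' h hm := by
    simp only [Finset.mem_filter, Finset.mem_univ, true_and] at hm ⊢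
    exact F.right_aligned _ j j' h hm
  top_aligned i i' j h hm := by
    simp only [Finset.mem_filter, Finset.mem_univ, true_and] at hm ⊢
    exact F.top_aligned _ _ j (Fin.succ_le_succ_iff.2 h) hm

@[simp] theorem mem_dropRow (F : FerrersDiagram (m + 1) n) (i : Fin m) (j : Fin n) :
    (i, j) ∈ F.dropRow.dots ↔ (i.succ, j) ∈ F.dots := by
  simp [dropRow]

/-- The number of dots in the top row. -/
def topLen (F : FerrersDiagram (m + 1) n) : ℕ :=
  (Finset.univ.filter fun j => ((0 : Fin (m + 1)), j) ∈ F.dots).card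

theorem topLen_le (F : FerrersDiagram (m + 1) n) : F.topLen ≤ n :=
  (Finset.card_filter_le _ _).trans (by simp)

theorem mem_top_iff (F : FerrersDiagram (m + 1) n) (j : Fin n) :
    (0, j) ∈ F.dots ↔ n - 1 - j.val < F.topLen := by
  constructor
  · intro h
    have : Finset.Ici j ⊆ Finset.univ.filter fun j => ((0 : Fin (m + 1)), j) ∈ F.dots := by
      intro k hk
      simp only [Finset.mem_Ici] at hk
      simp [F.right_aligned 0 j k hk h]
    have := Finset.card_le_card this
    rw [Fin.card_Ici] at this
    unfold topLen
    omega
  · intro h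
    by_contra hn
    have : (Finset.univ.filter fun j => ((0 : Fin (m + 1)), j) ∈ F.dots) ⊆ Finset.Ioi j := by
      intro k hk
      simp only [Finset.mem_filter, Finset.mem_univ, true_and] at hk
      rw [Finset.mem_Ioi]
      by_contra hle
      exact hn (F.right_aligned 0 k j (not_lt.1 hle) hk)
    have := Finset.card_le_card this
    rw [Fin.card_Ioi] at this
    unfold topLen at h
    omega

theorem diagCard_eq_sum (F : FerrersDiagram m n) (d : ℕ) :
    F.diagCard d = ∑ i : Fin m, ∑ j : Fin n,
      if (i, j) ∈ F.dots ∧ i.val + (n - 1 - j.val) = d then 1 else 0 := by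
  rw [← Fintype.sum_prod_type' (f := fun (i : Fin m) (j : Fin n) =>
    if (i, j) ∈ F.dots ∧ i.val + (n - 1 - j.val) = d then 1 else 0), ← Finset.card_filter,
    diagCard]
  congr 1
  ext x
  simp

theorem sum_top_diag (F : FerrersDiagram (m + 1) n) (d : ℕ) :
    (∑ j : Fin n, if ((0 : Fin (m + 1)), j) ∈ F.dots ∧ (n - 1 - j.val) = d then 1 else 0) =
      if d < F.topLen then 1 else 0 := by
  have hle := F.topLen_le
  split_ifs with h
  · rw [Finset.sum_eq_single (⟨n - 1 - d, by omega⟩ : Fin n)]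
    · rw [if_pos]
      rw [mem_top_iff]
      constructor <;> simp only <;> omega
    · intro b _ hb
      rw [if_neg]
      rintro ⟨-, h2⟩
      exact hb (Fin.ext (by simp only; omega))
    · simp
  · refine Finset.sum_eq_zero fun j _ => if_neg ?_
    rw [mem_top_iff]
    omega

theorem diagCard_zero (F : FerrersDiagram (m + 1) n) :
    F.diagCard 0 = if 0 < F.topLen then 1 else 0 := by
  rw [diagCard_eq_sum, Fin.sum_univ_succ, ← sum_top_diag]
  simp

/-- Deleting the top row shifts the diagonals by one, and the top row meets exactly the diagonals
`0, …, topLen - 1`, each once. -/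
theorem diagCard_succ (F : FerrersDiagram (m + 1) n) (d : ℕ) :
    F.diagCard (d + 1) = F.dropRow.diagCard d + if d + 1 < F.topLen then 1 else 0 := by
  rw [diagCard_eq_sum, Fin.sum_univ_succ, ← sum_top_diag, add_comm, diagCard_eq_sum]
  congr 1
  · refine Finset.sum_congr rfl fun i _ => Finset.sum_congr rfl fun j _ => ?_
    congr 1
    rw [mem_dropRow, Fin.val_succ, eq_iff_iff]
    refine and_congr Iff.rfl ?_
    omega
  · simp

theorem diagCard_le (F : FerrersDiagram m n) (d : ℕ) : F.diagCard d ≤ d + 1 := by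
  refine (Finset.card_le_card_of_injOn (t := Finset.range (d + 1)) (fun x => x.1.val) ?_ ?_).trans
    (Finset.card_range _).le
  · intro x hx
    simp only [Finset.coe_filter, Set.mem_ofPred_eq] at hx
    simp only [Finset.coe_range, Set.mem_Iio]
    omega
  · rintro ⟨a, b⟩ hx ⟨a', b'⟩ hy h
    simp only [Finset.coe_filter, Set.mem_ofPred_eq] at hx hy h
    ext <;> simp only <;> omega

theorem diagCard_le_topLen (F : FerrersDiagram (m + 1) n) (d : ℕ) : F.diagCard d ≤ F.topLen := by
  refine Finset.card_le_card_of_injOn (fun x => x.2) ?_ ?_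
  · intro x hx
    simp only [Finset.coe_filter, Set.mem_ofPred_eq, Finset.mem_univ, true_and] at hx ⊢
    exact F.top_aligned _ _ _ (Fin.zero_le _) hx.1
  · rintro ⟨a, b⟩ hx ⟨a', b'⟩ hy h
    simp only [Finset.coe_filter, Set.mem_ofPred_eq] at hx hy h
    subst h
    ext <;> simp only
    omega

theorem dropRow_diagCard_le_topLen (F : FerrersDiagram (m + 1) n) (d : ℕ) :
    F.dropRow.diagCard d ≤ F.topLen := by
  have := F.diagCard_le_topLen (d + 1)
  rw [diagCard_succ] at this
  omega

/-- In other words, a diagonal can only be shorter than the next one if it is full, with `d + 1`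
dots. In the induction on rows, the case where the top row misses both diagonals needs `topLen` as a
bound for the diagonals below. -/
theorem min_le_diagCard_of_succ (F : FerrersDiagram m n) (d : ℕ) :
    min (d + 1) (F.diagCard (d + 1)) ≤ F.diagCard d := by
  induction m generalizing d with
  | zero => simp [diagCard_eq_sum]
  | succ m ih =>
    rcases d with _ | d
    · have h1 := F.diagCard_le_topLen (0 + 1)
      rw [diagCard_zero]
      split_ifs <;> omega
    · have h1 := ih F.dropRow d
      have h2 := F.dropRow.diagCard_le (d + 1)
      have h3 := F.dropRow_diagCard_le_topLen (d + 1)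
      rw [F.diagCard_succ (d + 1), F.diagCard_succ d]
      split_ifs <;> omega

theorem min_le_diagCard (F : FerrersDiagram m n) {d d' : ℕ} (h : d ≤ d') :
    min (d + 1) (F.diagCard d') ≤ F.diagCard d := by
  induction d', h using Nat.le_induction with
  | base => exact min_le_right _ _
  | succ k hk ih =>
    have := F.min_le_diagCard_of_succ k
    omega

theorem sum_diagCard (F : FerrersDiagram m n) :
    ∑ d ∈ Finset.range (m + n), F.diagCard d = F.dots.card := by
  rw [Finset.card_eq_sum_card_fiberwise (f := fun x => x.1.val + (n - 1 - x.2.val))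
    (t := Finset.range (m + n))]
  · rfl
  · intro x _
    simp only [Finset.coe_range, Set.mem_Iio]
    omega

theorem rankDim_add_sum (F : FerrersDiagram m n) (r : ℕ) :
    F.rankDim r + ∑ d ∈ Finset.range (m + n), (F.diagCard d - r) = F.dots.card := by
  rw [rankDim, ← sum_diagCard, ← Finset.sum_add_distrib]
  exact Finset.sum_congr rfl fun d _ => by omega

theorem rankDim_succ (F : FerrersDiagram (m + 1) n) (r : ℕ) :
    F.rankDim r = min (if 0 < F.topLen then 1 else 0) r + ∑ d ∈ Finset.range (m + n),
      min (F.dropRow.diagCard d + if d + 1 < F.topLen then 1 else 0) r := by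
  rw [rankDim, show m + 1 + n = m + n + 1 by ring, Finset.sum_range_succ', add_comm,
    diagCard_zero]
  simp_rw [diagCard_succ]

theorem sum_range_lt (M k : ℕ) :
    (∑ d ∈ Finset.range M, if d + 1 < k then 1 else 0) = min M (k - 1) := by
  rw [← Finset.card_filter]
  have : (Finset.range M).filter (fun d => d + 1 < k) = Finset.range (min M (k - 1)) := by
    ext d
    simp only [Finset.mem_filter, Finset.mem_range]
    omega
  rw [this, Finset.card_range]

/-- Matrices of rank at most `r + 1` arise in two ways: a lower part of rank at most `r + 1` with
top row in a space of dimension at most `min (r + 1) topLen`, or a lower part of rank at most `r`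
with arbitrary top row. This lemma and the next bound both exponents by `rankDim (r + 1)`; the two
after them show that one of the exponents attains it. -/
theorem min_add_rankDim_dropRow_le (F : FerrersDiagram (m + 1) n) (r : ℕ) :
    min (r + 1) F.topLen + F.dropRow.rankDim (r + 1) ≤ F.rankDim (r + 1) := by
  have h : ∑ d ∈ Finset.range (m + n), (min (F.dropRow.diagCard d) (r + 1) +
      if d + 1 < min (r + 1) F.topLen then 1 else 0) ≤ ∑ d ∈ Finset.range (m + n),
      min (F.dropRow.diagCard d + if d + 1 < F.topLen then 1 else 0) (r + 1) := by
    refine Finset.sum_le_sum fun d _ => ?_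
    have := F.dropRow.diagCard_le d
    split_ifs <;> omega
  have hle := F.topLen_le
  rw [Finset.sum_add_distrib, sum_range_lt] at h
  rw [F.rankDim_succ, rankDim]
  split_ifs at * <;> omega

theorem topLen_add_rankDim_dropRow_le (F : FerrersDiagram (m + 1) n) (r : ℕ) :
    F.topLen + F.dropRow.rankDim r ≤ F.rankDim (r + 1) := by
  have h : ∑ d ∈ Finset.range (m + n), (min (F.dropRow.diagCard d) r +
      if d + 1 < F.topLen then 1 else 0) ≤ ∑ d ∈ Finset.range (m + n),
      min (F.dropRow.diagCard d + if d + 1 < F.topLen then 1 else 0) (r + 1) := by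
    refine Finset.sum_le_sum fun d _ => ?_
    split_ifs <;> omega
  have hle := F.topLen_le
  rw [Finset.sum_add_distrib, sum_range_lt] at h
  rw [F.rankDim_succ, rankDim]
  split_ifs at * <;> omega

theorem rankDim_le_topLen_add (F : FerrersDiagram (m + 1) n) (r : ℕ)
    (hr : ∀ d, F.topLen ≤ d + 1 → F.dropRow.diagCard d ≤ r) :
    F.rankDim (r + 1) ≤ F.topLen + F.dropRow.rankDim r := by
  have h : ∑ d ∈ Finset.range (m + n),
      min (F.dropRow.diagCard d + if d + 1 < F.topLen then 1 else 0) (r + 1) ≤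
      ∑ d ∈ Finset.range (m + n), (min (F.dropRow.diagCard d) r +
      if d + 1 < F.topLen then 1 else 0) := by
    refine Finset.sum_le_sum fun d _ => ?_
    have := hr d
    split_ifs <;> omega
  rw [Finset.sum_add_distrib, sum_range_lt] at h
  rw [F.rankDim_succ, rankDim]
  split_ifs at * <;> omega

/-- The long diagonal `d₀` forces every diagonal met by the top row to contain at least `min (d + 1)
(r + 1)` lower dots, so the cap absorbs the top dot except when `d < r`. -/
theorem rankDim_le_add (F : FerrersDiagram (m + 1) n) (r : ℕ) {d₀ : ℕ}
    (h₀ : F.topLen ≤ d₀ + 1) (hr : r < F.dropRow.diagCard d₀) :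
    F.rankDim (r + 1) ≤ (r + 1) + F.dropRow.rankDim (r + 1) := by
  have h : ∑ d ∈ Finset.range (m + n),
      min (F.dropRow.diagCard d + if d + 1 < F.topLen then 1 else 0) (r + 1) ≤
      ∑ d ∈ Finset.range (m + n), (min (F.dropRow.diagCard d) (r + 1) +
      if d + 1 < r + 1 then 1 else 0) := by
    refine Finset.sum_le_sum fun d _ => ?_
    by_cases hd : d + 1 < F.topLen
    · have := F.dropRow.min_le_diagCard (d := d) (d' := d₀) (by omega)
      split_ifs <;> omega
    · split_ifs <;> omega
  rw [Finset.sum_add_distrib, sum_range_lt] at h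
  rw [F.rankDim_succ, rankDim]
  split_ifs at * <;> omega

end FerrersDiagram

/-! ### Counting matrices of bounded rank over a finite field. -/

namespace FerrersDiagram

variable {m n : ℕ}

theorem shapeMatrix_mem (F : FerrersDiagram m n) {K : Type*} [Field K] (x : F.dots → K) :
    F.shapeMatrix x ∈ F.shapeSpace K := by
  intro i j h
  by_contra hn
  exact h (by simp [shapeMatrix, hn])

/-- The entries of a matrix of shape `F` at the dots of `F` determine it. -/
def shapeEquiv (F : FerrersDiagram m n) (K : Type*) [Field K] :
    (F.dots → K) ≃ₗ[K] F.shapeSpace K where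
  toFun x := ⟨F.shapeMatrix x, F.shapeMatrix_mem x⟩
  map_add' x y := by
    ext i j
    by_cases h : (i, j) ∈ F.dots <;> simp [shapeMatrix, h]
  map_smul' c x := by
    ext i j
    by_cases h : (i, j) ∈ F.dots <;> simp [shapeMatrix, h]
  invFun M x := M.1 x.1.1 x.1.2
  left_inv x := by
    ext ⟨⟨i, j⟩, h⟩
    simp [shapeMatrix, h]
  right_inv M := by
    ext i j
    by_cases h : (i, j) ∈ F.dots
    · simp [shapeMatrix, h]
    · have : M.1 i j = 0 := by
        by_contra hn
        exact h (M.2 i j hn)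
      simp [shapeMatrix, h, this]

theorem card_shapeSpace (F : FerrersDiagram m n) (K : Type*) [Field K] [Finite K] :
    Nat.card (F.shapeSpace K) = Nat.card K ^ F.dots.card := by
  rw [← Nat.card_congr (F.shapeEquiv K).toEquiv, Nat.card_fun, Nat.card_eq_fintype_card (α := F.dots),
    Fintype.card_coe]

instance (F : FerrersDiagram m n) (K : Type*) [Field K] [Finite K] : Finite (F.shapeSpace K) :=
  Finite.of_equiv _ (F.shapeEquiv K).toEquiv

/-- The possible top rows of matrices of shape `F`. -/
def topSpace (F : FerrersDiagram (m + 1) n) (K : Type*) [Field K] : Submodule K (Fin n → K) where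
  carrier := {v | ∀ j, ((0 : Fin (m + 1)), j) ∉ F.dots → v j = 0}
  zero_mem' := fun _ _ => rfl
  add_mem' := fun hv hw j hj => by simp [hv j hj, hw j hj]
  smul_mem' := fun c v hv j hj => by simp [hv j hj]

theorem card_topSpace (F : FerrersDiagram (m + 1) n) (K : Type*) [Field K] [Finite K] :
    Nat.card (F.topSpace K) = Nat.card K ^ F.topLen := by
  classical
  let φ : F.topSpace K ≃ ({j // ((0 : Fin (m + 1)), j) ∈ F.dots} → K) :=
    { toFun := fun v j => v.1 j.1
      invFun := fun x => ⟨fun j => if h : ((0 : Fin (m + 1)), j) ∈ F.dots then x ⟨j, h⟩ else 0,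
        fun j hj => by simp [hj]⟩
      left_inv := fun v => by
        ext j
        by_cases h : ((0 : Fin (m + 1)), j) ∈ F.dots
        · simp [h]
        · simp [h, v.2 j h]
      right_inv := fun x => by
        ext ⟨j, h⟩
        simp [h] }
  rw [Nat.card_congr φ, Nat.card_fun, Nat.card_eq_fintype_card
    (α := {j // ((0 : Fin (m + 1)), j) ∈ F.dots}), Fintype.card_subtype]
  rfl

/-- The matrix with top row `v` and remaining rows `B`. -/
def consRow {K : Type*} (v : Fin n → K) (B : Matrix (Fin m) (Fin n) K) :
    Matrix (Fin (m + 1)) (Fin n) K :=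
  Matrix.of (Fin.cons v B.row)

/-- A matrix of shape `F` is a top row together with a matrix of the remaining shape. -/
def consEquiv (F : FerrersDiagram (m + 1) n) (K : Type*) [Field K] :
    F.topSpace K × F.dropRow.shapeSpace K ≃ F.shapeSpace K where
  toFun x := ⟨consRow x.1.1 x.2.1, fun i j => by
    refine Fin.cases (fun h => ?_) (fun i h => ?_) i
    · by_contra hn
      exact h (x.1.2 j hn)
    · exact (F.mem_dropRow i j).1 (x.2.2 i j h)⟩
  invFun M := (⟨M.1 0, fun j hj => by
      by_contra hn
      exact hj (M.2 0 j hn)⟩,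
    ⟨Matrix.of fun i j => M.1 i.succ j, fun i j h => (F.mem_dropRow i j).2 (M.2 _ _ h)⟩)
  left_inv x := rfl
  right_inv M := by
    ext i j
    refine Fin.cases rfl (fun i => rfl) i

/-- The row space of a matrix. -/
abbrev rowSpan {K : Type*} [Field K] (B : Matrix (Fin m) (Fin n) K) : Submodule K (Fin n → K) :=
  Submodule.span K (Set.range B.row)

theorem rank_eq_finrank_rowSpan {K : Type*} [Field K] (B : Matrix (Fin m) (Fin n) K) :
    B.rank = Module.finrank K (rowSpan B) :=
  B.rank_eq_finrank_span_row

theorem rowSpan_cons {K : Type*} [Field K] (v : Fin n → K) (B : Matrix (Fin m) (Fin n) K) :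
    rowSpan (consRow v B) =
      Submodule.span K {v} ⊔ rowSpan B := by
  change Submodule.span K (Set.range (Fin.cons v B.row : Fin (m + 1) → Fin n → K)) = _
  rw [Fin.range_cons, Submodule.span_insert]

theorem rank_cons_le {K : Type*} [Field K] (v : Fin n → K) (B : Matrix (Fin m) (Fin n) K) :
    (consRow v B).rank ≤ B.rank + 1 := by
  rw [rank_eq_finrank_rowSpan, rowSpan_cons, rank_eq_finrank_rowSpan B, add_comm]
  exact (Submodule.finrank_add_le_finrank_add_finrank _ _).trans
    (Nat.add_le_add_right ((finrank_span_le_card ({v} : Set (Fin n → K))).trans (by simp)) _)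

theorem rank_le_rank_cons {K : Type*} [Field K] (v : Fin n → K) (B : Matrix (Fin m) (Fin n) K) :
    B.rank ≤ (consRow v B).rank := by
  rw [rank_eq_finrank_rowSpan B, rank_eq_finrank_rowSpan (consRow v B), rowSpan_cons]
  exact Submodule.finrank_mono le_sup_right

theorem rank_cons_le_rank_iff {K : Type*} [Field K] (v : Fin n → K)
    (B : Matrix (Fin m) (Fin n) K) :
    (consRow v B).rank ≤ B.rank ↔ v ∈ rowSpan B := by
  rw [rank_eq_finrank_rowSpan, rowSpan_cons, rank_eq_finrank_rowSpan B,
    ← Submodule.span_singleton_le_iff_mem]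
  constructor
  · intro h
    exact sup_eq_right.1 (Submodule.eq_of_le_of_finrank_le le_sup_right h).symm
  · intro h
    rw [sup_eq_right.2 h]

/-- This is where top alignment enters the count: every vector in the span of the lower rows is an
admissible top row. -/
theorem rowSpan_le_topSpace (F : FerrersDiagram (m + 1) n) {K : Type*} [Field K]
    (B : F.dropRow.shapeSpace K) : rowSpan B.1 ≤ F.topSpace K := by
  rw [Submodule.span_le]
  rintro _ ⟨i, rfl⟩ j hj
  by_contra hn
  exact hj (F.top_aligned i.succ 0 j (Fin.zero_le _) ((F.mem_dropRow i j).1 (B.2 i j hn)))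

/-- The number of matrices of shape `F` and rank at most `r`. -/
noncomputable def lowRankCard (F : FerrersDiagram m n) (r : ℕ) (K : Type*) [Field K] : ℕ :=
  Nat.card {A : F.shapeSpace K // A.1.rank ≤ r}

/-- The number of top rows that extend `B` to a matrix of rank at most `r`. -/
noncomputable def extensionCard (F : FerrersDiagram (m + 1) n) (r : ℕ) {K : Type*} [Field K]
    (B : F.dropRow.shapeSpace K) : ℕ :=
  Nat.card {v : F.topSpace K //
    (consRow v.1 B.1).rank ≤ r}

theorem lowRankCard_eq_sum (F : FerrersDiagram (m + 1) n) (r : ℕ) (K : Type*) [Field K] [Finite K]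
    [Fintype (F.dropRow.shapeSpace K)] :
    F.lowRankCard r K = ∑ B : F.dropRow.shapeSpace K, F.extensionCard r B := by
  unfold extensionCard
  rw [← Nat.card_sigma, lowRankCard]
  refine Nat.card_congr (Equiv.symm ?_)
  have e₁ : (Σ B : F.dropRow.shapeSpace K, {v : F.topSpace K // (consRow v.1 B.1).rank ≤ r}) ≃
      {x : F.topSpace K × F.dropRow.shapeSpace K // (consRow x.1.1 x.2.1).rank ≤ r} :=
    { toFun := fun x => ⟨(x.2.1, x.1), x.2.2⟩
      invFun := fun x => ⟨x.1.2, ⟨x.1.1, x.2⟩⟩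
      left_inv := fun _ => rfl
      right_inv := fun _ => rfl }
  exact e₁.trans (Equiv.subtypeEquiv (F.consEquiv K) fun _ => Iff.rfl)

theorem lowRankCard_eq_sum_ite (F : FerrersDiagram m n) (r : ℕ) (K : Type*) [Field K] [Finite K]
    [Fintype (F.shapeSpace K)] (c : ℕ) :
    c * F.lowRankCard r K = ∑ B : F.shapeSpace K, if B.1.rank ≤ r then c else 0 := by
  classical
  rw [← Finset.sum_filter, Finset.sum_const, smul_eq_mul, mul_comm, lowRankCard,
    Nat.card_eq_fintype_card, Fintype.card_subtype]

/-- If `B` has rank at most `r`, any top row works; if its rank is exactly `r + 1`, only vectors of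
its row space do, and there are `q ^ (r + 1)` of them. -/
theorem extensionCard_le (F : FerrersDiagram (m + 1) n) (r : ℕ) {K : Type*} [Field K] [Finite K]
    (B : F.dropRow.shapeSpace K) :
    F.extensionCard (r + 1) B ≤
      (if B.1.rank ≤ r + 1 then Nat.card K ^ min (r + 1) F.topLen else 0) +
      (if B.1.rank ≤ r then Nat.card K ^ F.topLen else 0) := by
  by_cases h1 : B.1.rank ≤ r
  · rw [if_pos h1, ← card_topSpace]
    exact le_add_left (Nat.card_le_card_of_injective _ Subtype.val_injective)
  by_cases h2 : B.1.rank ≤ r + 1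
  · rw [if_pos h2, if_neg h1, add_zero]
    have hr : B.1.rank = r + 1 := by omega
    have hf : Module.finrank K (rowSpan B.1) = r + 1 := by rw [← rank_eq_finrank_rowSpan, hr]
    have hT : Module.finrank K (rowSpan B.1) ≤ F.topLen := by
      refine (Submodule.finrank_mono (F.rowSpan_le_topSpace B)).trans ?_
      have h3 := F.card_topSpace K
      rw [Module.natCard_eq_pow_finrank (K := K)] at h3
      exact (Nat.pow_right_injective Finite.one_lt_card h3).le
    rw [min_eq_left (by omega), ← hf, ← Module.natCard_eq_pow_finrank]
    refine Nat.card_le_card_of_injective (fun v => ⟨v.1.1, ?_⟩) ?_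
    · rw [← rank_cons_le_rank_iff]
      exact v.2.trans (rank_eq_finrank_rowSpan B.1).ge
    · intro v w h
      exact Subtype.ext (Subtype.ext (Subtype.mk.inj h))
  · have : IsEmpty {v : F.topSpace K //
        (consRow v.1 B.1).rank ≤ r + 1} :=
      ⟨fun v => h2 ((rank_le_rank_cons v.1.1 B.1).trans v.2)⟩
    rw [extensionCard, Nat.card_of_isEmpty]
    exact Nat.zero_le _

theorem extensionCard_of_rank_le (F : FerrersDiagram (m + 1) n) (r : ℕ) {K : Type*} [Field K]
    [Finite K] (B : F.dropRow.shapeSpace K) (hB : B.1.rank ≤ r) :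
    F.extensionCard (r + 1) B = Nat.card K ^ F.topLen := by
  rw [← card_topSpace]
  exact Nat.card_congr (Equiv.subtypeUnivEquiv fun v => (rank_cons_le _ _).trans (by omega))

theorem le_extensionCard (F : FerrersDiagram (m + 1) n) (r : ℕ) {K : Type*} [Field K] [Finite K]
    (hr : r + 1 ≤ F.topLen) (B : F.dropRow.shapeSpace K) (hB : B.1.rank ≤ r + 1) :
    Nat.card K ^ (r + 1) ≤ F.extensionCard (r + 1) B := by
  by_cases h1 : B.1.rank ≤ r
  · rw [extensionCard_of_rank_le F r B h1]
    exact Nat.pow_le_pow_right Nat.card_pos hr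
  · have hr : B.1.rank = r + 1 := by omega
    rw [← hr, rank_eq_finrank_rowSpan, ← Module.natCard_eq_pow_finrank,
      ← rank_eq_finrank_rowSpan]
    refine Nat.card_le_card_of_injective
      (fun v => ⟨⟨v.1, F.rowSpan_le_topSpace B v.2⟩, (rank_cons_le_rank_iff _ _).2 v.2⟩) ?_
    intro v w h
    exact Subtype.ext (congrArg (fun z => z.1.1) h)

theorem lowRankCard_succ_le (F : FerrersDiagram (m + 1) n) (r : ℕ) (K : Type*) [Field K]
    [Finite K] : F.lowRankCard (r + 1) K ≤
      Nat.card K ^ min (r + 1) F.topLen * F.dropRow.lowRankCard (r + 1) K +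
      Nat.card K ^ F.topLen * F.dropRow.lowRankCard r K := by
  have := Fintype.ofFinite (F.dropRow.shapeSpace K)
  rw [lowRankCard_eq_sum, lowRankCard_eq_sum_ite, lowRankCard_eq_sum_ite, ← Finset.sum_add_distrib]
  exact Finset.sum_le_sum fun B _ => F.extensionCard_le r B

theorem topLen_mul_lowRankCard_le (F : FerrersDiagram (m + 1) n) (r : ℕ) (K : Type*) [Field K]
    [Finite K] :
    Nat.card K ^ F.topLen * F.dropRow.lowRankCard r K ≤ F.lowRankCard (r + 1) K := by
  have := Fintype.ofFinite (F.dropRow.shapeSpace K)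
  rw [lowRankCard_eq_sum, lowRankCard_eq_sum_ite]
  refine Finset.sum_le_sum fun B _ => ?_
  split_ifs with h
  · exact (F.extensionCard_of_rank_le r B h).ge
  · exact Nat.zero_le _

theorem pow_mul_lowRankCard_le (F : FerrersDiagram (m + 1) n) (r : ℕ) (K : Type*) [Field K]
    [Finite K] (hr : r + 1 ≤ F.topLen) :
    Nat.card K ^ (r + 1) * F.dropRow.lowRankCard (r + 1) K ≤ F.lowRankCard (r + 1) K := by
  have := Fintype.ofFinite (F.dropRow.shapeSpace K)
  rw [lowRankCard_eq_sum, lowRankCard_eq_sum_ite]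
  refine Finset.sum_le_sum fun B _ => ?_
  split_ifs with h
  · exact F.le_extensionCard r hr B h
  · exact Nat.zero_le _

theorem lowRankCard_pos (F : FerrersDiagram m n) (r : ℕ) (K : Type*) [Field K] [Finite K] :
    0 < F.lowRankCard r K := by
  have : Nonempty {A : F.shapeSpace K // A.1.rank ≤ r} := ⟨⟨0, by simp⟩⟩
  exact Nat.card_pos

theorem lowRankCard_zero_le (F : FerrersDiagram m n) (K : Type*) [Field K] [Finite K] :
    F.lowRankCard 0 K ≤ 1 := by
  have : Subsingleton {A : F.shapeSpace K // A.1.rank ≤ 0} := by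
    have h : ∀ A : {A : F.shapeSpace K // A.1.rank ≤ 0}, A.1.1 = 0 := by
      intro A
      have h1 := A.2
      rw [Nat.le_zero, rank_eq_finrank_rowSpan, Submodule.finrank_eq_zero,
        Submodule.span_eq_bot] at h1
      ext i j
      exact congrFun (h1 _ ⟨i, rfl⟩) j
    exact ⟨fun A B => Subtype.ext (Subtype.ext ((h A).trans (h B).symm))⟩
  exact Finite.card_le_one_iff_subsingleton.2 this

/-- Each row contributes a factor `2`, because both ways of extending the lower part are bounded by
the same power of `q`. -/
theorem lowRankCard_le (F : FerrersDiagram m n) (r : ℕ) (K : Type*) [Field K] [Finite K] :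
    F.lowRankCard r K ≤ 2 ^ m * Nat.card K ^ F.rankDim r := by
  have hq : 0 < Nat.card K := Nat.card_pos
  have h0 : ∀ {m : ℕ} (F : FerrersDiagram m n),
      F.lowRankCard 0 K ≤ 2 ^ m * Nat.card K ^ F.rankDim 0 := fun F =>
    (F.lowRankCard_zero_le K).trans (Nat.mul_pos (by positivity) (by positivity))
  induction m generalizing r with
  | zero =>
    rcases r with _ | r
    · exact h0 F
    · refine le_trans ?_ (Nat.mul_pos (by positivity) (by positivity) : 0 < _)
      have : Subsingleton {A : F.shapeSpace K // A.1.rank ≤ r + 1} :=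
        ⟨fun A B => Subtype.ext (Subtype.ext (Subsingleton.elim _ _))⟩
      exact Finite.card_le_one_iff_subsingleton.2 this
  | succ m ih =>
    rcases r with _ | r
    · exact h0 F
    · refine (F.lowRankCard_succ_le r K).trans ?_
      have h1 : Nat.card K ^ min (r + 1) F.topLen * F.dropRow.lowRankCard (r + 1) K ≤
          2 ^ m * Nat.card K ^ F.rankDim (r + 1) := by
        calc _ ≤ Nat.card K ^ min (r + 1) F.topLen *
              (2 ^ m * Nat.card K ^ F.dropRow.rankDim (r + 1)) :=
              Nat.mul_le_mul_left _ (ih F.dropRow (r + 1))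
          _ = 2 ^ m * Nat.card K ^ (min (r + 1) F.topLen + F.dropRow.rankDim (r + 1)) := by ring
          _ ≤ _ := Nat.mul_le_mul_left _
              (Nat.pow_le_pow_right hq (F.min_add_rankDim_dropRow_le r))
      have h2 : Nat.card K ^ F.topLen * F.dropRow.lowRankCard r K ≤
          2 ^ m * Nat.card K ^ F.rankDim (r + 1) := by
        calc _ ≤ Nat.card K ^ F.topLen * (2 ^ m * Nat.card K ^ F.dropRow.rankDim r) :=
              Nat.mul_le_mul_left _ (ih F.dropRow r)
          _ = 2 ^ m * Nat.card K ^ (F.topLen + F.dropRow.rankDim r) := by ring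
          _ ≤ _ := Nat.mul_le_mul_left _
              (Nat.pow_le_pow_right hq (F.topLen_add_rankDim_dropRow_le r))
      calc _ ≤ _ := Nat.add_le_add h1 h2
        _ = _ := by ring

theorem le_lowRankCard (F : FerrersDiagram m n) (r : ℕ) (K : Type*) [Field K] [Finite K] :
    Nat.card K ^ F.rankDim r ≤ F.lowRankCard r K := by
  have hq : 0 < Nat.card K := Nat.card_pos
  have h0 : ∀ {m : ℕ} (F : FerrersDiagram m n) (r : ℕ), F.rankDim r = 0 →
      Nat.card K ^ F.rankDim r ≤ F.lowRankCard r K := fun F r h => by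
    rw [h, pow_zero]
    exact F.lowRankCard_pos r K
  induction m generalizing r with
  | zero => exact h0 F r (by simp [rankDim, diagCard_eq_sum])
  | succ m ih =>
    rcases r with _ | r
    · exact h0 F 0 (by simp [rankDim])
    -- This condition decides which of the two ways of extending has the dominant exponent.
    · by_cases hd : ∀ d, F.topLen ≤ d + 1 → F.dropRow.diagCard d ≤ r
      · calc _ ≤ Nat.card K ^ (F.topLen + F.dropRow.rankDim r) :=
              Nat.pow_le_pow_right hq (F.rankDim_le_topLen_add r hd)
          _ = Nat.card K ^ F.topLen * Nat.card K ^ F.dropRow.rankDim r := pow_add _ _ _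
          _ ≤ _ := Nat.mul_le_mul_left _ (ih F.dropRow r)
          _ ≤ _ := F.topLen_mul_lowRankCard_le r K
      · push Not at hd
        obtain ⟨d, hd1, hd2⟩ := hd
        have := F.dropRow_diagCard_le_topLen d
        calc _ ≤ Nat.card K ^ ((r + 1) + F.dropRow.rankDim (r + 1)) :=
              Nat.pow_le_pow_right hq (F.rankDim_le_add r hd1 hd2)
          _ = Nat.card K ^ (r + 1) * Nat.card K ^ F.dropRow.rankDim (r + 1) := pow_add _ _ _
          _ ≤ _ := Nat.mul_le_mul_left _ (ih F.dropRow (r + 1))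
          _ ≤ _ := F.pow_mul_lowRankCard_le r K (by omega)

end FerrersDiagram

/-! ### Reed-Solomon codes on diagonals. -/

namespace FerrersDiagram

variable {m n : ℕ}

/-- A matrix which vanishes below a diagonal has rank at least the number of its nonzero entries on
that diagonal. -/
theorem card_le_rank_of_diagonal {K : Type*} [Field K] (M : Matrix (Fin m) (Fin n) K) (d : ℕ)
    (hM : ∀ a b, d < a.val + (n - 1 - b.val) → M a b = 0) (T : Finset (Fin m × Fin n))
    (hT : ∀ x ∈ T, x.1.val + (n - 1 - x.2.val) = d ∧ M x.1 x.2 ≠ 0) : T.card ≤ M.rank := by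
  classical
  have hinj : Set.InjOn (Prod.fst : Fin m × Fin n → Fin m) T := by
    rintro ⟨a, b⟩ hx ⟨a', b'⟩ hy h
    have h1 := (hT _ hx).1
    have h2 := (hT _ hy).1
    simp only at h h1 h2
    subst h
    ext <;> simp only
    omega
  have hcol : ∀ a : T.image Prod.fst, ∃ b, (a.1, b) ∈ T := by
    rintro ⟨a, ha⟩
    obtain ⟨x, hx, rfl⟩ := Finset.mem_image.1 ha
    exact ⟨x.2, hx⟩
  choose c hc using hcol
  -- The dots of `T` lie in distinct rows; ordered by row they form the diagonal of `B`, and an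
  -- entry of `B` under that diagonal lies beyond the `d`-th diagonal of `M`.
  let B : Matrix (T.image Prod.fst) (T.image Prod.fst) K := M.submatrix Subtype.val c
  have htri : B.IsUpperTriangular := by
    intro x y hxy
    have hxy' : y.1.val < x.1.val := hxy
    have h2 := (hT _ (hc y)).1
    exact hM _ _ (by simp only at h2; omega)
  have hdet : B.det ≠ 0 := by
    rw [Matrix.det_of_isUpperTriangular htri]
    exact Finset.prod_ne_zero_iff.2 fun x _ => (hT _ (hc x)).2
  have h := Matrix.rank_of_det_ne_zero hdet
  rw [Fintype.card_coe, Finset.card_image_of_injOn hinj] at h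
  rw [← h]
  exact Matrix.rank_submatrix_le _ _ _

/-- Over an infinite field, Reed-Solomon codes placed on the diagonals form a code of shape `F`. -/
theorem exists_code (F : FerrersDiagram m n) {N r : ℕ} (hN : N + F.rankDim r ≤ F.dots.card)
    (K : Type*) [Field K] [Infinite K] :
    ∃ A : Fin N → F.shapeSpace K, ∀ x : Fin N → K, x ≠ 0 →
      r + 1 ≤ (∑ k, x k • (A k : Matrix (Fin m) (Fin n) K)).rank := by
  classical
  have hcard : Fintype.card (Fin N) ≤
      Fintype.card (Σ d : Fin (m + n), Fin (F.diagCard d - r)) := by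
    have := F.rankDim_add_sum r
    rw [Fintype.card_fin, Fintype.card_sigma]
    simp only [Fintype.card_fin]
    rw [Fin.sum_univ_eq_sum_range (fun d => F.diagCard d - r)]
    omega
  -- `ι` assigns to each basis matrix a diagonal `d` and a monomial of degree below `diagCard d -
  -- r`; by `rankDim_add_sum` there are `t - rankDim r` such pairs.
  obtain ⟨ι⟩ := Function.Embedding.nonempty_of_card_le hcard
  let α : Fin m ↪ K := Fin.valEmbedding.trans (Infinite.natEmbedding K)
  let A : Fin N → Matrix (Fin m) (Fin n) K := fun k => Matrix.of fun i j =>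
    if (i, j) ∈ F.dots ∧ i.val + (n - 1 - j.val) = (ι k).1.val then α i ^ (ι k).2.val else 0
  have hA : ∀ k, A k ∈ F.shapeSpace K := by
    intro k i j h
    by_contra hn
    exact h (by simp [A, hn])
  refine ⟨fun k => ⟨A k, hA k⟩, fun x hx => ?_⟩
  -- On the last diagonal that occurs, the combination consists of the values of one nonzero
  -- polynomial `P`; beyond it the combination vanishes.
  obtain ⟨k, hk, hmax⟩ : ∃ k, x k ≠ 0 ∧ ∀ l, x l ≠ 0 → (ι l).1 ≤ (ι k).1 := by
    have hne : (Finset.univ.filter fun k => x k ≠ 0).Nonempty := by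
      obtain ⟨k, hk⟩ := Function.ne_iff.1 hx
      exact ⟨k, by simpa using hk⟩
    obtain ⟨k, hk, h⟩ := Finset.exists_max_image _ (fun k => (ι k).1) hne
    exact ⟨k, by simpa using hk, fun l hl => h l (by simpa using hl)⟩
  set d := (ι k).1 with hd
  let P : Polynomial K := ∑ l, if (ι l).1 = d then Polynomial.monomial (ι l).2.val (x l) else 0
  have hPcoeff : P.coeff (ι k).2.val = x k := by
    simp only [P, Polynomial.finsetSum_coeff]
    rw [Finset.sum_eq_single k]
    · simp [hd]
    · intro l _ hl
      split_ifs with h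
      · rw [Polynomial.coeff_monomial, if_neg]
        intro h'
        refine hl (ι.injective (Sigma.ext h ?_))
        exact (Fin.heq_ext_iff (by rw [h])).2 h'
      · simp
    · simp
  have hP0 : P ≠ 0 := fun h => hk (by rw [← hPcoeff, h, Polynomial.coeff_zero])
  have hDr : 0 < F.diagCard d - r := (ι k).2.pos
  have hPdeg : P.natDegree ≤ F.diagCard d - r - 1 := by
    refine Polynomial.natDegree_sum_le_of_forall_le _ _ fun l _ => ?_
    split_ifs with h
    · refine (Polynomial.natDegree_monomial_le _).trans ?_
      have h1 := (ι l).2.2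
      have h2 : F.diagCard (ι l).1 = F.diagCard d := by rw [h]
      omega
    · simp
  have hentry : ∀ i j, (i, j) ∈ F.dots → i.val + (n - 1 - j.val) = d →
      (∑ l, x l • A l) i j = P.eval (α i) := by
    intro i j hij hd'
    rw [Matrix.sum_apply, Polynomial.eval_finsetSum]
    refine Finset.sum_congr rfl fun l _ => ?_
    by_cases h : (ι l).1 = d
    · rw [if_pos h, Polynomial.eval_monomial]
      simp [A, hij, hd', h]
    · have h' : ¬ (d.val = (ι l).1.val) := fun h' => h (Fin.ext h'.symm)
      rw [if_neg h]
      simp [A, hd', h']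
  have hzero : ∀ i j, d.val < i.val + (n - 1 - j.val) → (∑ l, x l • A l) i j = 0 := by
    intro i j hij
    rw [Matrix.sum_apply]
    refine Finset.sum_eq_zero fun l _ => ?_
    by_cases hl : x l = 0
    · simp [hl]
    · have := hmax l hl
      rw [Fin.le_def] at this
      have h' : ¬ (i.val + (n - 1 - j.val) = (ι l).1.val) := by omega
      simp [A, h']
  let S := F.dots.filter fun y => y.1.val + (n - 1 - y.2.val) = d
  let Z := S.filter fun y => P.eval (α y.1) = 0
  let T := S.filter fun y => ¬ P.eval (α y.1) = 0
  have hZT : Z.card + T.card = F.diagCard d := Finset.card_filter_add_card_filter_not _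
  have hZ : Z.card ≤ P.natDegree := by
    refine le_trans ?_ ((Multiset.toFinset_card_le _).trans P.card_roots')
    refine Finset.card_le_card_of_injOn (fun y => α y.1) ?_ ?_
    · intro y hy
      have hy' : P.eval (α y.1) = 0 := (Finset.mem_filter.1 hy).2
      simp [hP0, hy']
    · rintro ⟨a, b⟩ hx' ⟨a', b'⟩ hy h
      have h1 := (Finset.mem_filter.1 (Finset.mem_filter.1 hx').1).2
      have h2 := (Finset.mem_filter.1 (Finset.mem_filter.1 hy).1).2
      have h3 := α.injective h
      simp only at h1 h2 h3
      subst h3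
      ext <;> simp only
      omega
  -- `P` has at most `diagCard d - r - 1` roots among distinct evaluation points.
  refine le_trans (by omega : r + 1 ≤ T.card) (card_le_rank_of_diagonal _ d hzero T ?_)
  rintro ⟨i, j⟩ hy
  have h1 := Finset.mem_filter.1 hy
  have h2 := Finset.mem_filter.1 h1.1
  refine ⟨h2.2, ?_⟩
  rw [hentry i j h2.1 h2.2]
  exact h1.2

end FerrersDiagram

/-! ### First and second moments of the number of combinations landing in a set. -/

section Moments

variable {K W : Type*} [Field K] [AddCommGroup W] [Module K W]

/-- A linear section identifies `G` with `H × ker φ`. So a uniform tuple has uniform image under a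
surjective linear map. -/
theorem LinearMap.card_preimage_mul {G H : Type*} [AddCommGroup G] [Module K G] [AddCommGroup H]
    [Module K H] (φ : G →ₗ[K] H) (hφ : Function.Surjective φ) (V : Set H) :
    Nat.card {g // φ g ∈ V} * Nat.card H = Nat.card V * Nat.card G := by
  obtain ⟨s, hs⟩ := φ.exists_rightInverse_of_surjective (LinearMap.range_eq_top.2 hφ)
  have hs' : ∀ h, φ (s h) = h := fun h => LinearMap.congr_fun hs h
  let e : G ≃ H × LinearMap.ker φ :=
    { toFun := fun g => (φ g, ⟨g - s (φ g), by simp [hs']⟩)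
      invFun := fun p => s p.1 + p.2.1
      left_inv := fun g => by simp
      right_inv := fun p => by
        have h : φ p.2.1 = 0 := p.2.2
        ext <;> simp [hs', h] }
  have e' : {g // φ g ∈ V} ≃ V × LinearMap.ker φ :=
    (Equiv.subtypeEquiv e (q := fun p => p.1 ∈ V) fun _ => Iff.rfl).trans
      { toFun := fun p => (⟨p.1.1, p.2⟩, p.1.2)
        invFun := fun p => ⟨(p.1.1, p.2), p.1.2⟩
        left_inv := fun _ => rfl
        right_inv := fun _ => rfl }
  rw [Nat.card_congr e, Nat.card_congr e', Nat.card_prod, Nat.card_prod]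
  ring

variable {N : ℕ}

/-- The linear combination of a tuple of vectors with coefficients `x`. -/
def tupleComb (W : Type*) [AddCommGroup W] [Module K W] (x : Fin N → K) : (Fin N → W) →ₗ[K] W :=
  ∑ k, x k • LinearMap.proj k

theorem tupleComb_apply (x : Fin N → K) (A : Fin N → W) :
    tupleComb W x A = ∑ k, x k • A k := by
  simp [tupleComb]

theorem tupleComb_single (x : Fin N → K) (i : Fin N) (w : W) :
    tupleComb W x (Pi.single i w) = x i • w := by
  rw [tupleComb_apply, Finset.sum_eq_single i]
  · simp
  · intro j _ hj
    simp [hj]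
  · simp

theorem tupleComb_surjective {x : Fin N → K} (hx : x ≠ 0) :
    Function.Surjective (tupleComb W x) := by
  intro w
  obtain ⟨i, hi⟩ := Function.ne_iff.1 hx
  refine ⟨Pi.single i ((x i)⁻¹ • w), ?_⟩
  rw [tupleComb_single, smul_smul, mul_inv_cancel₀ hi, one_smul]

/-- Some 2×2 minor of `(x, y)` is nonzero, and Cramer's rule solves for two entries of the tuple.
This is the pairwise independence behind the second moment. -/
theorem tupleComb_prod_surjective {x y : Fin N → K} (hx : x ≠ 0) (hy : ∀ c : K, y ≠ c • x) :
    Function.Surjective ((tupleComb W x).prod (tupleComb W y)) := by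
  obtain ⟨i, hi⟩ := Function.ne_iff.1 hx
  obtain ⟨j, hj⟩ := Function.ne_iff.1 (hy (y i / x i))
  have hi' : x i ≠ 0 := hi
  have hΔ : x i * y j - x j * y i ≠ 0 := by
    intro h
    apply hj
    simp only [Pi.smul_apply, smul_eq_mul]
    field_simp
    linear_combination h
  rintro ⟨v, w⟩
  refine ⟨Pi.single i ((x i * y j - x j * y i)⁻¹ • (y j • v - x j • w)) +
    Pi.single j ((x i * y j - x j * y i)⁻¹ • (x i • w - y i • v)), ?_⟩
  simp only [LinearMap.prod_apply, Function.prod_apply, map_add, tupleComb_single, Prod.mk_add_mk,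
    Prod.mk.injEq]
  constructor
  · calc _ = ((x i * y j - x j * y i)⁻¹ * (x i * y j - x j * y i)) • v := by module
      _ = v := by rw [inv_mul_cancel₀ hΔ, one_smul]
  · calc _ = ((x i * y j - x j * y i)⁻¹ * (x i * y j - x j * y i)) • w := by module
      _ = w := by rw [inv_mul_cancel₀ hΔ, one_smul]

/-- The tuples with a nontrivial linear combination in `V`. -/
def hitting (N : ℕ) (K : Type*) {W : Type*} [Field K] [AddCommGroup W] [Module K W] (V : Set W) :
    Set (Fin N → W) :=
  {A | ∃ x : Fin N → K, x ≠ 0 ∧ tupleComb W x A ∈ V}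

open Classical in
theorem sum_card_comb_mem [Fintype K] [Fintype W] (V : Set W) :
    (∑ A : Fin N → W, (Finset.univ.filter fun x : Fin N → K => x ≠ 0 ∧ tupleComb W x A ∈ V).card) *
      Fintype.card W = (Fintype.card K ^ N - 1) * (Nat.card V * Fintype.card W ^ N) := by
  have h1 : (∑ A : Fin N → W,
      (Finset.univ.filter fun x : Fin N → K => x ≠ 0 ∧ tupleComb W x A ∈ V).card) =
      ∑ x ∈ Finset.univ.filter (fun x : Fin N → K => x ≠ 0),
        (Finset.univ.filter fun A : Fin N → W => tupleComb W x A ∈ V).card := by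
    simp_rw [Finset.card_filter]
    rw [Finset.sum_comm, Finset.sum_filter]
    refine Finset.sum_congr rfl fun x _ => ?_
    by_cases hx : x = 0 <;> simp [hx]
  have h2 : (Finset.univ.filter (fun x : Fin N → K => x ≠ 0)).card = Fintype.card K ^ N - 1 := by
    rw [Finset.filter_ne', Finset.card_erase_of_mem (Finset.mem_univ _), Finset.card_univ]
    simp
  rw [h1, Finset.sum_mul, ← h2, ← smul_eq_mul, ← Finset.sum_const]
  refine Finset.sum_congr rfl fun x hx => ?_
  have h3 := LinearMap.card_preimage_mul (tupleComb W x)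
    (tupleComb_surjective (Finset.mem_filter.1 hx).2) V
  rw [Nat.card_eq_fintype_card (α := W), Nat.card_eq_fintype_card (α := Fin N → W),
    Nat.card_eq_fintype_card (α := {g // tupleComb W x g ∈ V}), Fintype.card_subtype] at h3
  simpa using h3

open Classical in
/-- First moment bound for cones. -/
theorem mul_card_hitting_le [Finite K] [Finite W] (V : Set W)
    (hV : ∀ (c : K) (w : W), w ∈ V → c • w ∈ V) :
    (Nat.card K - 1) * Nat.card (hitting N K V) * Nat.card W ≤
      (Nat.card K ^ N - 1) * (Nat.card V * Nat.card W ^ N) := by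
  have := Fintype.ofFinite K
  have := Fintype.ofFinite W
  rw [Nat.card_eq_fintype_card (α := K), Nat.card_eq_fintype_card (α := W), ← sum_card_comb_mem]
  refine Nat.mul_le_mul_right _ ?_
  rw [Nat.card_eq_fintype_card, Fintype.card_subtype, mul_comm, ← smul_eq_mul, ← Finset.sum_const]
  refine (Finset.sum_le_sum fun A hA => ?_).trans
    (Finset.sum_le_sum_of_subset (Finset.subset_univ _))
  obtain ⟨x, hx, hxA⟩ := (Finset.mem_filter.1 hA).2
  have h2 : (Finset.univ.filter (fun c : K => c ≠ 0)).card = Fintype.card K - 1 := by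
    rw [Finset.filter_ne', Finset.card_erase_of_mem (Finset.mem_univ _), Finset.card_univ]
  rw [← h2]
  -- As `V` is a cone, one good `x` brings all its `q - 1` nonzero multiples; this saves the factor
  -- `q - 1`.
  refine Finset.card_le_card_of_injOn (fun c => c • x) ?_ ?_
  · intro c hc
    have hc' : c ≠ 0 := by simpa using hc
    simp only [Finset.coe_filter, Finset.mem_univ, true_and, Set.mem_ofPred_eq]
    refine ⟨smul_ne_zero hc' hx, ?_⟩
    have : tupleComb W (c • x) A = c • tupleComb W x A := by
      simp [tupleComb_apply, Finset.smul_sum, smul_smul]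
    rw [this]
    exact hV c _ hxA
  · intro c _ d _ hcd
    exact smul_left_injective K hx hcd

open Classical in
-- Expand the square over pairs `(x, y)`. Proportional pairs, at most `q` for each `x`, are bounded
-- by dropping the condition on `y`; for the other pairs the two combinations are independent.
theorem sum_sq_card_comb_mem_le [Fintype K] [Fintype W] (V : Set W) :
    (∑ A : Fin N → W,
      (Finset.univ.filter fun x : Fin N → K => x ≠ 0 ∧ tupleComb W x A ∈ V).card ^ 2) *
      Fintype.card W ^ 2 ≤
      (Fintype.card K ^ N - 1) * Fintype.card K * (Nat.card V * Fintype.card W ^ (N + 1)) +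
      (Fintype.card K ^ N - 1) ^ 2 * (Nat.card V ^ 2 * Fintype.card W ^ N) := by
  set X := Finset.univ.filter (fun x : Fin N → K => x ≠ 0) with hX
  have hXc : X.card = Fintype.card K ^ N - 1 := by
    rw [hX, Finset.filter_ne', Finset.card_erase_of_mem (Finset.mem_univ _), Finset.card_univ]
    simp
  have h1 : (∑ A : Fin N → W,
      (Finset.univ.filter fun x : Fin N → K => x ≠ 0 ∧ tupleComb W x A ∈ V).card ^ 2) =
      ∑ x ∈ X, ∑ y ∈ X,
        (Finset.univ.filter fun A : Fin N → W => tupleComb W x A ∈ V ∧ tupleComb W y A ∈ V).card := by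
    have h : ∀ A : Fin N → W,
        (Finset.univ.filter fun x : Fin N → K => x ≠ 0 ∧ tupleComb W x A ∈ V).card ^ 2 =
        ∑ x ∈ X, ∑ y ∈ X, if tupleComb W x A ∈ V ∧ tupleComb W y A ∈ V then 1 else 0 := by
      intro A
      rw [← Finset.filter_filter, Finset.card_filter, sq, Finset.sum_mul_sum]
      refine Finset.sum_congr rfl fun x _ => Finset.sum_congr rfl fun y _ => ?_
      rw [ite_and]
      split_ifs <;> simp
    simp_rw [h]
    rw [Finset.sum_comm]
    refine Finset.sum_congr rfl fun x _ => ?_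
    rw [Finset.sum_comm]
    simp_rw [Finset.card_filter]
  have h2 : ∀ x ∈ X, ∀ y ∈ X,
      (Finset.univ.filter fun A : Fin N → W =>
        tupleComb W x A ∈ V ∧ tupleComb W y A ∈ V).card * Fintype.card W ^ 2 ≤
      (if ∃ c : K, y = c • x then Nat.card V * Fintype.card W ^ (N + 1) else 0) +
        Nat.card V ^ 2 * Fintype.card W ^ N := by
    intro x hx y _
    have hx0 := (Finset.mem_filter.1 hx).2
    split_ifs with hc
    · refine le_add_right ?_
      have h3 := LinearMap.card_preimage_mul (tupleComb W x) (tupleComb_surjective hx0) V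
      rw [Nat.card_eq_fintype_card (α := W), Nat.card_eq_fintype_card (α := Fin N → W),
        Nat.card_eq_fintype_card (α := {g // tupleComb W x g ∈ V}), Fintype.card_subtype,
        Fintype.card_fun, Fintype.card_fin] at h3
      rw [pow_succ (Fintype.card W) N, ← mul_assoc, ← h3, sq, ← mul_assoc]
      refine Nat.mul_le_mul_right _ (Nat.mul_le_mul_right _ (Finset.card_le_card ?_))
      intro A hA
      simp only [Finset.mem_filter, Finset.mem_univ, true_and] at hA ⊢
      exact hA.1
    · push Not at hc
      have h3 := LinearMap.card_preimage_mul _ (tupleComb_prod_surjective (W := W) hx0 hc) (V ×ˢ V)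
      rw [Nat.card_congr (Equiv.Set.prod V V), Nat.card_prod, Nat.card_prod,
        Nat.card_eq_fintype_card (α := W), Nat.card_eq_fintype_card (α := Fin N → W),
        Nat.card_eq_fintype_card (α := {g // (tupleComb W x).prod (tupleComb W y) g ∈ V ×ˢ V}),
        Fintype.card_subtype, Fintype.card_fun, Fintype.card_fin] at h3
      rw [zero_add, sq, sq, ← h3]
      refine Nat.mul_le_mul_right _ (Finset.card_le_card ?_)
      intro A hA
      simpa [Set.mem_prod] using hA
  have h3 : ∀ x ∈ X, (X.filter fun y => ∃ c : K, y = c • x).card ≤ Fintype.card K := by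
    intro x _
    rw [← Finset.card_univ]
    refine (Finset.card_le_card (t := Finset.univ.image fun c : K => c • x) ?_).trans
      Finset.card_image_le
    intro y hy
    obtain ⟨c, rfl⟩ := (Finset.mem_filter.1 hy).2
    exact Finset.mem_image_of_mem _ (Finset.mem_univ c)
  rw [h1]
  simp_rw [Finset.sum_mul]
  refine (Finset.sum_le_sum fun x hx => (Finset.sum_le_sum fun y hy => h2 x hx y hy)).trans ?_
  simp_rw [Finset.sum_add_distrib, Finset.sum_const, smul_eq_mul, ← Finset.sum_filter,
    Finset.sum_const, smul_eq_mul, ← hXc]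
  refine Nat.add_le_add ?_ (by rw [sq (Finset.card X), mul_assoc])
  rw [mul_assoc, ← smul_eq_mul X.card, ← Finset.sum_const]
  exact Finset.sum_le_sum fun x hx => Nat.mul_le_mul_right _ (h3 x hx)

open Classical in
/-- Second moment bound. -/
theorem card_le_three_mul_card_hitting [Finite K] [Finite W] (V : Set W)
    (hV : Nat.card K * Nat.card W ≤ Nat.card K ^ N * Nat.card V) :
    Nat.card W ^ N ≤ 3 * Nat.card (hitting N K V) := by
  have := Fintype.ofFinite K
  have := Fintype.ofFinite W
  rw [Nat.card_eq_fintype_card (α := K), Nat.card_eq_fintype_card (α := W)] at hV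
  rw [Nat.card_eq_fintype_card (α := W)]
  have hM1 := sum_card_comb_mem (K := K) (N := N) V
  have hM2 := sum_sq_card_comb_mem_le (K := K) (N := N) V
  set f : (Fin N → W) → ℕ := fun A =>
    (Finset.univ.filter fun x : Fin N → K => x ≠ 0 ∧ tupleComb W x A ∈ V).card with hf
  have hB : Nat.card (hitting N K V) = (Finset.univ.filter fun A => A ∈ hitting N K V).card := by
    rw [Nat.card_eq_fintype_card, Fintype.card_subtype]
  set B := Finset.univ.filter fun A => A ∈ hitting N K V
  have hfB : ∑ A, f A = ∑ A ∈ B, f A := by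
    refine (Finset.sum_subset (Finset.subset_univ _) fun A _ hA => ?_).symm
    rw [hf]
    simp only [Finset.card_eq_zero]
    rw [Finset.filter_eq_empty_iff]
    intro x _ hx
    exact hA (Finset.mem_filter.2 ⟨Finset.mem_univ _, x, hx⟩)
  -- Cauchy-Schwarz on the support of `f`.
  have hCS : (∑ A, f A) ^ 2 ≤ B.card * ∑ A, f A ^ 2 := by
    rw [hfB]
    refine (sq_sum_le_card_mul_sum_sq).trans (Nat.mul_le_mul_left _ ?_)
    exact Finset.sum_le_sum_of_subset (Finset.subset_univ _)
  rw [hB]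
  have hq : 1 < Fintype.card K := Fintype.one_lt_card
  have hw : 0 < Fintype.card W := Fintype.card_pos
  have hv : 0 < Nat.card V := by
    rcases Nat.eq_zero_or_pos (Nat.card V) with h | h
    · rw [h, mul_zero] at hV
      have := Nat.mul_pos (by omega : 0 < Fintype.card K) hw
      omega
    · exact h
  have hN : Fintype.card K ^ N ≤ 2 * (Fintype.card K ^ N - 1) := by
    rcases N with _ | N
    -- For `N = 0` the hypothesis would read `q * |W| ≤ |V|`, which is impossible.
    · exfalso
      have h1 : Nat.card V ≤ Nat.card W := Nat.card_le_card_of_injective _ Subtype.val_injective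
      rw [Nat.card_eq_fintype_card (α := W)] at h1
      rw [pow_zero, one_mul] at hV
      have : 2 * Fintype.card W ≤ Fintype.card K * Fintype.card W := Nat.mul_le_mul_right _ hq
      omega
    · have : 1 < Fintype.card K ^ (N + 1) := Nat.one_lt_pow (by omega) hq
      omega
  set X := Fintype.card K ^ N - 1
  set q := Fintype.card K
  set w := Fintype.card W
  set v := Nat.card V
  set S₁ := ∑ A, f A
  set S₂ := ∑ A, f A ^ 2
  have hXpos : 0 < X := by
    have : 0 < q ^ N := Nat.pow_pos (by omega)
    omega
  have h4 : q * w ≤ 2 * (X * v) := by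
    calc q * w ≤ q ^ N * v := hV
      _ ≤ 2 * X * v := Nat.mul_le_mul_right _ hN
      _ = _ := by ring
  have h5 : (X * (v * w ^ N)) ^ 2 ≤
      B.card * (X * q * (v * w ^ (N + 1)) + X ^ 2 * (v ^ 2 * w ^ N)) := by
    calc (X * (v * w ^ N)) ^ 2 = S₁ ^ 2 * w ^ 2 := by rw [← hM1]; ring
      _ ≤ (B.card * S₂) * w ^ 2 := Nat.mul_le_mul_right _ hCS
      _ = B.card * (S₂ * w ^ 2) := by ring
      _ ≤ _ := Nat.mul_le_mul_left _ hM2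
  -- By `h4`, the proportional pairs contribute at most twice the main term, whence the constant
  -- `3`.
  have h6 : X * q * (v * w ^ (N + 1)) + X ^ 2 * (v ^ 2 * w ^ N) ≤ 3 * (X ^ 2 * v ^ 2 * w ^ N) := by
    calc _ = X * v * w ^ N * (q * w) + X ^ 2 * (v ^ 2 * w ^ N) := by ring
      _ ≤ X * v * w ^ N * (2 * (X * v)) + X ^ 2 * (v ^ 2 * w ^ N) :=
        Nat.add_le_add_right (Nat.mul_le_mul_left _ h4) _
      _ = _ := by ring
  have h7 : (X ^ 2 * v ^ 2 * w ^ N) * w ^ N ≤ (X ^ 2 * v ^ 2 * w ^ N) * (3 * B.card) := by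
    calc _ = (X * (v * w ^ N)) ^ 2 := by ring
      _ ≤ _ := h5
      _ ≤ B.card * (3 * (X ^ 2 * v ^ 2 * w ^ N)) := Nat.mul_le_mul_left _ h6
      _ = _ := by ring
  exact Nat.le_of_mul_le_mul_left h7 (by positivity)

end Moments

/-! ### Success probabilities of random tuples over finite fields. -/

namespace FerrersDiagram

variable {m n : ℕ}

theorem coe_tupleComb (F : FerrersDiagram m n) {K : Type*} [Field K] {N : ℕ} (x : Fin N → K)
    (A : Fin N → F.shapeSpace K) : (tupleComb (F.shapeSpace K) x A : Matrix (Fin m) (Fin n) K) =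
      ∑ k, x k • (A k : Matrix (Fin m) (Fin n) K) := by
  simp [tupleComb_apply]

/-- The matrices of shape `F` and rank at most `r`. -/
def lowRank (F : FerrersDiagram m n) (r : ℕ) (K : Type*) [Field K] : Set (F.shapeSpace K) :=
  {A | A.1.rank ≤ r}

theorem notMem_hitting_lowRank_iff (F : FerrersDiagram m n) {K : Type*} [Field K] {N r : ℕ}
    (A : Fin N → F.shapeSpace K) : A ∉ hitting N K (F.lowRank r K) ↔
      F.IsCodeAtLeast N (r + 1) (Submodule.span K
        (Set.range fun k => (A k : Matrix (Fin m) (Fin n) K))) := by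
  rw [F.isCodeAtLeast_span_iff (by omega) _ fun k => (A k).2]
  simp only [hitting, lowRank, Set.mem_ofPred_eq, not_exists, not_and, coe_tupleComb, not_le]
  rfl

theorem card_tuples_pos (F : FerrersDiagram m n) (N : ℕ) (K : Type*) [Field K] [Finite K] :
    (0 : ℝ) < Nat.card (Fin N → F.shapeSpace K) := by
  exact_mod_cast Nat.card_pos

theorem spanProb_eq (F : FerrersDiagram m n) (N r : ℕ) (K : Type*) [Field K] [Finite K] :
    F.spanProb N K (F.IsCodeAtLeast N (r + 1)) =
      1 - (Nat.card (hitting N K (F.lowRank r K)) : ℝ) / Nat.card (Fin N → F.shapeSpace K) := by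
  classical
  have h0 := F.card_tuples_pos N K
  have h : Nat.card {A : Fin N → F.shapeSpace K // F.IsCodeAtLeast N (r + 1)
      (Submodule.span K (Set.range fun k => (A k : Matrix (Fin m) (Fin n) K)))} +
      Nat.card (hitting N K (F.lowRank r K)) = Nat.card (Fin N → F.shapeSpace K) := by
    simp_rw [← notMem_hitting_lowRank_iff]
    rw [← Nat.card_congr (Equiv.Set.sumCompl (hitting N K (F.lowRank r K))), Nat.card_sum, add_comm]
    rfl
  rw [spanProb, eq_sub_iff_add_eq, ← add_div, div_eq_one_iff_eq h0.ne']
  exact_mod_cast h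

theorem spanProb_le_one (F : FerrersDiagram m n) (N : ℕ) (K : Type*) [Field K] [Finite K]
    (P : Submodule K (Matrix (Fin m) (Fin n) K) → Prop) : F.spanProb N K P ≤ 1 := by
  refine (div_le_one (F.card_tuples_pos N K)).2 ?_
  exact_mod_cast Nat.card_le_card_of_injective _ Subtype.val_injective

/-- If `N` is too large, then random tuples of length `N` often do not span a code. -/
theorem spanProb_le (F : FerrersDiagram m n) {N r : ℕ} (h : F.dots.card < N + F.rankDim r)
    (K : Type*) [Field K] [Finite K] :
    F.spanProb N K (F.IsCodeAtLeast N (r + 1)) ≤ 2 / 3 := by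
  have h1 : Nat.card K * Nat.card (F.shapeSpace K) ≤
      Nat.card K ^ N * Nat.card (F.lowRank r K) := by
    calc _ = Nat.card K ^ (F.dots.card + 1) := by rw [card_shapeSpace]; ring
      _ ≤ Nat.card K ^ (N + F.rankDim r) := Nat.pow_le_pow_right Nat.card_pos h
      _ = Nat.card K ^ N * Nat.card K ^ F.rankDim r := pow_add _ _ _
      _ ≤ _ := Nat.mul_le_mul_left _ (F.le_lowRankCard r K)
  have h2 := card_le_three_mul_card_hitting _ h1
  have h0 := F.card_tuples_pos N K
  rw [spanProb_eq, sub_le_comm, le_div_iff₀ h0]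
  have h4 : Nat.card (Fin N → F.shapeSpace K) = Nat.card (F.shapeSpace K) ^ N := by
    rw [Nat.card_fun, Nat.card_eq_fintype_card (α := Fin N), Fintype.card_fin]
  rw [← h4] at h2
  have h3 : (Nat.card (Fin N → F.shapeSpace K) : ℝ) ≤
      3 * Nat.card (hitting N K (F.lowRank r K)) := by exact_mod_cast h2
  linarith

/-- The first moment bound in probabilistic form, applied to the low rank matrices with `c = 2 ^ m`
and to `{0}` with `s = 0`. -/
theorem card_hitting_div_le (F : FerrersDiagram m n) {N s c : ℕ} (h : N + s ≤ F.dots.card)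
    (K : Type*) [Field K] [Finite K] (V : Set (F.shapeSpace K))
    (hV : ∀ (c : K) (w : F.shapeSpace K), w ∈ V → c • w ∈ V)
    (hc : Nat.card V ≤ c * Nat.card K ^ s) :
    (Nat.card (hitting N K V) : ℝ) / Nat.card (Fin N → F.shapeSpace K) ≤
      c / (Nat.card K - 1 : ℝ) := by
  have hq : 1 < Nat.card K := Finite.one_lt_card
  have hq' : (0 : ℝ) < Nat.card K - 1 := by
    have : (1 : ℝ) < Nat.card K := by exact_mod_cast hq
    linarith
  have h1 := mul_card_hitting_le (N := N) V hV
  have h2 : (Nat.card K - 1) * Nat.card (hitting N K V) * Nat.card (F.shapeSpace K) ≤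
      c * Nat.card (F.shapeSpace K) ^ N * Nat.card (F.shapeSpace K) := by
    calc _ ≤ _ := h1
      _ ≤ Nat.card K ^ N * (c * Nat.card K ^ s * Nat.card (F.shapeSpace K) ^ N) :=
        Nat.mul_le_mul (Nat.sub_le _ _) (Nat.mul_le_mul_right _ hc)
      _ = c * Nat.card (F.shapeSpace K) ^ N * Nat.card K ^ (N + s) := by ring
      _ ≤ _ := by
        refine Nat.mul_le_mul_left _ ?_
        rw [card_shapeSpace]
        exact Nat.pow_le_pow_right Nat.card_pos h
  have h3 := Nat.le_of_mul_le_mul_right h2 Nat.card_pos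
  rw [div_le_div_iff₀ (F.card_tuples_pos N K) hq', Nat.card_fun, Nat.card_eq_fintype_card (α := Fin N),
    Fintype.card_fin]
  have h4 : (((Nat.card K - 1 : ℕ) : ℝ)) * Nat.card (hitting N K V) ≤
      c * (Nat.card (F.shapeSpace K) ^ N : ℕ) := by exact_mod_cast h3
  rw [Nat.cast_sub hq.le, Nat.cast_one] at h4
  linarith

/-- If `N` is small enough, then random tuples of length `N` span a code with high probability. -/
theorem le_spanProb (F : FerrersDiagram m n) {N r : ℕ} (h : N + F.rankDim r ≤ F.dots.card)
    (K : Type*) [Field K] [Finite K] :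
    1 - 2 ^ m / (Nat.card K - 1 : ℝ) ≤ F.spanProb N K (F.IsCodeAtLeast N (r + 1)) := by
  rw [spanProb_eq]
  have := F.card_hitting_div_le (c := 2 ^ m) h K (F.lowRank r K) (fun c w hw => by
    refine le_trans (?_ : (c • w.1).rank ≤ w.1.rank) hw
    rw [rank_eq_finrank_rowSpan, rank_eq_finrank_rowSpan]
    refine Submodule.finrank_mono ?_
    rw [Submodule.span_le]
    rintro _ ⟨i, rfl⟩
    exact Submodule.smul_mem _ c (Submodule.subset_span ⟨i, rfl⟩)) (F.lowRankCard_le r K)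
  push_cast at this
  linarith

/-- The probability that `N` random matrices of shape `F` are linearly independent. -/
noncomputable def indepProb (F : FerrersDiagram m n) (N : ℕ) (K : Type*) [Field K] : ℝ :=
  (Nat.card {A : Fin N → F.shapeSpace K // LinearIndependent K A} : ℝ) /
    (Nat.card (Fin N → F.shapeSpace K) : ℝ)

theorem indepProb_le_one (F : FerrersDiagram m n) (N : ℕ) (K : Type*) [Field K] [Finite K] :
    F.indepProb N K ≤ 1 := by
  refine (div_le_one (F.card_tuples_pos N K)).2 ?_
  exact_mod_cast Nat.card_le_card_of_injective _ Subtype.val_injective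

theorem le_indepProb (F : FerrersDiagram m n) {N : ℕ} (h : N ≤ F.dots.card)
    (K : Type*) [Field K] [Finite K] :
    1 - 1 / (Nat.card K - 1 : ℝ) ≤ F.indepProb N K := by
  classical
  have h0 := F.card_tuples_pos N K
  have h1 := F.card_hitting_div_le (c := 1) (s := 0) h K {0} (fun c w hw => by
    rw [Set.mem_singleton_iff] at hw ⊢
    rw [hw, smul_zero]) (by simp)
  have h2 : Nat.card {A : Fin N → F.shapeSpace K // LinearIndependent K A} +
      Nat.card (hitting N K ({0} : Set (F.shapeSpace K))) = Nat.card (Fin N → F.shapeSpace K) := by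
    have h3 : ∀ A : Fin N → F.shapeSpace K, LinearIndependent K A ↔
        A ∈ (hitting N K ({0} : Set (F.shapeSpace K)))ᶜ := by
      intro A
      rw [Fintype.linearIndependent_iff]
      simp only [hitting, Set.mem_compl_iff, Set.mem_ofPred_eq, not_exists, not_and,
        Set.mem_singleton_iff, tupleComb_apply]
      constructor
      · intro h x hx h0
        exact hx (funext (h x h0))
      · intro h x h0
        by_contra hne
        exact h x (fun hx => hne fun i => congrFun hx i) h0
    rw [← Nat.card_congr (Equiv.Set.sumCompl (hitting N K ({0} : Set (F.shapeSpace K)))),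
      Nat.card_sum, add_comm]
    congr 1
    exact Nat.card_congr (Equiv.subtypeEquivRight h3)
  have h3 : F.indepProb N K = 1 - (Nat.card (hitting N K ({0} : Set (F.shapeSpace K))) : ℝ) /
      Nat.card (Fin N → F.shapeSpace K) := by
    rw [indepProb, eq_sub_iff_add_eq, ← add_div, div_eq_one_iff_eq h0.ne']
    exact_mod_cast h2
  rw [h3]
  push_cast at h1
  linarith

end FerrersDiagram

/-! ### Elimination theory. -/

theorem isZariskiOpen_of_forall_exists {σ K : Type*} [Field K] {U : Set (σ → K)}
    (h : ∀ a ∈ U, ∃ f : MvPolynomial σ K, MvPolynomial.eval a f ≠ 0 ∧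
      ∀ b, MvPolynomial.eval b f ≠ 0 → b ∈ U) : IsZariskiOpen U := by
  refine ⟨MvPolynomial.vanishingIdeal K Uᶜ, Set.ext fun a => ⟨fun ha hz => ?_, fun ha => ?_⟩⟩
  · obtain ⟨f, hf, hfU⟩ := h a ha
    have := hz f fun b hb => by
      by_contra hne
      exact hb (hfU b (by simpa [MvPolynomial.aeval_eq_eval] using hne))
    exact hf (by simpa [MvPolynomial.aeval_eq_eval] using this)
  · by_contra hn
    exact ha (MvPolynomial.zeroLocus_vanishingIdeal_le _ hn)

namespace MvPolynomial

variable {ν K : Type*} [Field K]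

theorem homogeneousComponent_mul_of_isHomogeneous {f : MvPolynomial ν K} {δ : ℕ}
    (hf : f.IsHomogeneous δ) (c : MvPolynomial ν K) (E : ℕ) :
    homogeneousComponent (E + δ) (c * f) = homogeneousComponent E c * f := by
  have h : ∀ i, homogeneousComponent (E + δ) (homogeneousComponent i c * f) =
      if i = E then homogeneousComponent E c * f else 0 := by
    intro i
    rw [homogeneousComponent_of_mem ((homogeneousComponent_isHomogeneous i c).mul hf)]
    by_cases hi : i = E
    · simp [hi]
    · rw [if_neg (by omega), if_neg hi]
  conv_lhs => rw [← sum_homogeneousComponent c, Finset.sum_mul, map_sum]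
  simp_rw [h]
  rw [Finset.sum_ite_eq']
  split_ifs with hE
  · rfl
  · rw [Finset.mem_range] at hE
    rw [homogeneousComponent_eq_zero E c (by omega), zero_mul]

/-- If finitely many forms of the same degree have no nontrivial common zero, then all monomials of
some degree are combinations of them, with homogeneous coefficients. -/
theorem exists_monomial_eq_sum [IsAlgClosed K] [Finite ν] {J : Type*} [Fintype J] {δ : ℕ}
    (hδ : 1 ≤ δ) (f : J → MvPolynomial ν K) (hf : ∀ i, (f i).IsHomogeneous δ)
    (h : ∀ x : ν → K, x ≠ 0 → ∃ i, eval x (f i) ≠ 0) :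
    ∃ E : ℕ, ∀ β : ν →₀ ℕ, β.degree = E + δ → ∃ g : J → MvPolynomial ν K,
      (∀ i, (g i).IsHomogeneous E) ∧ ∑ i, g i * f i = monomial β 1 := by
  -- Nullstellensatz: every common zero is the origin.
  have hrad : idealOfVars ν K ≤ (Ideal.span (Set.range f)).radical := by
    rw [← vanishingIdeal_zeroLocus_eq_radical (K := K), idealOfVars, Ideal.span_le]
    rintro _ ⟨k, rfl⟩ x hx
    have hx0 : x = 0 := by
      by_contra hne
      obtain ⟨i, hi⟩ := h x hne
      exact hi (by simpa [aeval_eq_eval] using hx (f i) (Ideal.subset_span ⟨i, rfl⟩))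
    simp [hx0]
  obtain ⟨E, hE⟩ := Ideal.exists_pow_le_of_le_radical_of_fg hrad (idealOfVars_fg ν K)
  refine ⟨E, fun β hβ => ?_⟩
  have hmem : monomial β (1 : K) ∈ Ideal.span (Set.range f) :=
    hE ((monomial_mem_pow_idealOfVars_iff E β one_ne_zero).2 (by omega))
  obtain ⟨c, hc⟩ := Ideal.mem_span_range_iff_exists_fun.1 hmem
  -- Comparing components of degree `E + δ` makes the coefficients homogeneous.
  refine ⟨fun i => homogeneousComponent E (c i), fun i => homogeneousComponent_isHomogeneous _ _, ?_⟩
  have := congrArg (homogeneousComponent (E + δ)) hc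
  rw [map_sum, homogeneousComponent_of_mem (isHomogeneous_monomial _ hβ), if_pos rfl] at this
  rw [← this]
  exact Finset.sum_congr rfl fun i _ =>
    (homogeneousComponent_mul_of_isHomogeneous (hf i) _ _).symm

theorem eval_eq_sum_of_isHomogeneous [Fintype ν] [DecidableEq ν] {f : MvPolynomial ν K} {D : ℕ}
    (hf : f.IsHomogeneous D) (x : ν → K) :
    eval x f = ∑ β : (Finset.univ : Finset ν).finsuppAntidiag D,
      f.coeff β.1 * ∏ i, x i ^ β.1 i := by
  rw [eval_eq', Finset.sum_coe_sort ((Finset.univ : Finset ν).finsuppAntidiag D)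
    (fun β => f.coeff β * ∏ i, x i ^ β i)]
  refine Finset.sum_subset (fun β hβ => ?_) fun β _ hβ => ?_
  · rw [Finset.mem_finsuppAntidiag]
    refine ⟨?_, Finset.subset_univ _⟩
    have := hf (mem_support_iff.1 hβ)
    rw [← Finsupp.degree_eq_sum, Finsupp.degree_eq_weight_one]
    exact this
  · rw [notMem_support_iff.1 hβ, zero_mul]

/-- The main theorem of elimination theory: the parameters for which forms in `x` have no nontrivial
common zero form an open set. -/
theorem isZariskiOpen_no_common_zero [IsAlgClosed K] [Fintype ν] {σ J : Type*} [Fintype J]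
    {δ : ℕ} (hδ : 1 ≤ δ) (f : J → MvPolynomial ν (MvPolynomial σ K))
    (hf : ∀ i, (f i).IsHomogeneous δ) :
    IsZariskiOpen {a : σ → K | ∀ x : ν → K, x ≠ 0 → ∃ i, eval x (map (eval a) (f i)) ≠ 0} := by
  classical
  refine isZariskiOpen_of_forall_exists fun a ha => ?_
  obtain ⟨E, hE⟩ := exists_monomial_eq_sum hδ (fun i => map (eval a) (f i))
    (fun i => (hf i).map _) ha
  let B := (Finset.univ : Finset ν).finsuppAntidiag (E + δ)
  have hB : ∀ β : B, β.1.degree = E + δ := fun β => by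
    rw [Finsupp.degree_eq_sum]
    exact (Finset.mem_finsuppAntidiag.1 β.2).1
  choose g hg hgf using fun β : B => hE β.1 (hB β)
  -- The coefficients `g` found at the point `a` are frozen while the parameters in `f` vary. The
  -- matrix `P` of coefficients of the `Q β` is the identity at `a`, so its determinant cuts out a
  -- neighbourhood of `a`.
  let Q : B → MvPolynomial ν (MvPolynomial σ K) := fun β => ∑ i, map C (g β i) * f i
  have hQ : ∀ β, (Q β).IsHomogeneous (E + δ) := fun β =>
    IsHomogeneous.sum _ _ _ fun i _ => ((hg β i).map _).mul (hf i)
  have hQmap : ∀ b β, map (eval b) (Q β) = ∑ i, g β i * map (eval b) (f i) := by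
    intro b β
    rw [map_sum]
    refine Finset.sum_congr rfl fun i _ => ?_
    rw [map_mul, map_map]
    congr 1
    have : (eval b).comp (C : K →+* MvPolynomial σ K) = RingHom.id K := by ext; simp
    rw [this, map_id]
  let P : Matrix B B (MvPolynomial σ K) := Matrix.of fun β γ => (Q β).coeff γ.1
  refine ⟨P.det, ?_, fun b hb x hx => ?_⟩
  · have : (eval a).mapMatrix P = 1 := by
      ext β γ
      change eval a ((Q β).coeff γ.1) = _
      rw [← coeff_map, hQmap, hgf, coeff_monomial, Matrix.one_apply]
      simp only [Subtype.ext_iff]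
    rw [RingHom.map_det, this, Matrix.det_one]
    exact one_ne_zero
  · by_contra! hzero
    rw [RingHom.map_det] at hb
    -- A common zero `x` puts the vector of its monomials of degree `E + δ` into the kernel of `P`
    -- at `b`; that vector contains the pure powers of the coordinates.
    have hmul : Matrix.mulVec ((eval b).mapMatrix P) (fun γ => ∏ i, x i ^ γ.1 i) = 0 := by
      funext β
      have h1 := eval_eq_sum_of_isHomogeneous ((hQ β).map (eval b)) x
      rw [hQmap, map_sum] at h1
      simp only [map_mul, hzero, mul_zero, Finset.sum_const_zero, ← hQmap, coeff_map] at h1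
      exact h1.symm
    have hvec := Matrix.eq_zero_of_mulVec_eq_zero hb hmul
    apply hx
    funext k
    have hk := congrFun hvec ⟨Finsupp.single k (E + δ), by
      rw [Finset.mem_finsuppAntidiag]
      exact ⟨by rw [← Finsupp.degree_eq_sum, Finsupp.degree_single], Finset.subset_univ _⟩⟩
    simp only [Pi.zero_apply] at hk
    rw [Finset.prod_eq_single k] at hk
    · rw [Finsupp.single_eq_same] at hk
      exact eq_zero_of_pow_eq_zero hk
    · intro i _ hi
      simp [Ne.symm hi]
    · simp

end MvPolynomial

/-! ### Minors, and openness of the locus of good tuples. -/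

namespace Matrix

theorem exists_linearIndependent_rows {m n : Type*} [Fintype m] [Fintype n] {K : Type*} [Field K]
    (B : Matrix m n K) {δ : ℕ} (h : δ ≤ B.rank) :
    ∃ ρ : Fin δ → m, (B.submatrix ρ id).rank = δ := by
  rw [rank_eq_finrank_span_row] at h
  obtain ⟨f, hf, -, hli⟩ := Submodule.exists_fun_fin_finrank_span_eq K (Set.range B.row)
  choose ρ hρ using hf
  refine ⟨ρ ∘ Fin.castLE h, ?_⟩
  have : LinearIndependent K (B.submatrix (ρ ∘ Fin.castLE h) id).row := by
    convert! hli.comp _ (Fin.castLE_injective h) using 1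
    funext i
    exact hρ _
  rw [this.rank_matrix, Fintype.card_fin]

/-- Choose independent rows, then independent columns among those. The index maps need not be
injective, since a repetition makes the determinant vanish. -/
theorem le_rank_iff_exists_minor {m n : Type*} [Fintype m] [Fintype n] {K : Type*} [Field K]
    (B : Matrix m n K) (δ : ℕ) :
    δ ≤ B.rank ↔ ∃ x : (Fin δ → m) × (Fin δ → n), (B.submatrix x.1 x.2).det ≠ 0 := by
  constructor
  · intro h
    obtain ⟨ρ, hρ⟩ := B.exists_linearIndependent_rows h
    rw [← rank_transpose] at hρ
    obtain ⟨κ, hκ⟩ := (B.submatrix ρ id).transpose.exists_linearIndependent_rows hρ.ge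
    refine ⟨(ρ, κ), fun h0 => ?_⟩
    have h1 : (B.submatrix ρ κ).transpose.rank = δ := hκ
    obtain ⟨v, hv, hv0⟩ := exists_mulVec_eq_zero_iff.2 h0
    rw [rank_transpose] at h1
    have h2 := (B.submatrix ρ κ).mulVecLin.finrank_range_add_finrank_ker
    rw [Module.finrank_fintype_fun_eq_card, Fintype.card_fin] at h2
    have h3 : Module.finrank K (LinearMap.ker (B.submatrix ρ κ).mulVecLin) = 0 := by
      unfold rank at h1
      omega
    rw [Submodule.finrank_eq_zero] at h3
    have h4 : v ∈ LinearMap.ker (B.submatrix ρ κ).mulVecLin := hv0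
    rw [h3] at h4
    exact hv h4
  · rintro ⟨x, hx⟩
    have := rank_of_det_ne_zero hx
    rw [Fintype.card_fin] at this
    rw [← this]
    exact rank_submatrix_le _ _ _

end Matrix

namespace FerrersDiagram

variable {m n : ℕ}

open MvPolynomial in
-- The `δ`-minors of the generic combination `G` are forms of degree `δ` in the coefficients, with
-- the entries of the tuple as parameters; a tuple is bad exactly when they have a nontrivial common
-- zero.
theorem isZariskiOpen_spanLocus (F : FerrersDiagram m n) {N δ : ℕ} (hδ : 1 ≤ δ) (K : Type*)
    [Field K] [IsAlgClosed K] : IsZariskiOpen (F.spanLocus N K (F.IsCodeAtLeast N δ)) := by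
  classical
  let G : Matrix (Fin m) (Fin n) (MvPolynomial (Fin N) (MvPolynomial (Fin N × F.dots) K)) :=
    Matrix.of fun i j => if h : (i, j) ∈ F.dots then
      ∑ k, C (X (k, ⟨(i, j), h⟩)) * X k else 0
  let f : (Fin δ → Fin m) × (Fin δ → Fin n) →
      MvPolynomial (Fin N) (MvPolynomial (Fin N × F.dots) K) := fun y => (G.submatrix y.1 y.2).det
  have hG : ∀ i j, (G i j).IsHomogeneous 1 := by
    intro i j
    simp only [G, Matrix.of_apply]
    split_ifs with h
    · exact IsHomogeneous.sum _ _ _ fun k _ => isHomogeneous_C_mul_X _ _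
    · exact isHomogeneous_zero _ _ _
  have hf : ∀ y, (f y).IsHomogeneous δ := by
    intro y
    simp only [f, Matrix.det_apply']
    refine IsHomogeneous.sum _ _ _ fun s _ => ?_
    have h1 := IsHomogeneous.prod Finset.univ
      (fun i => G.submatrix y.1 y.2 (s i) i) (fun _ => 1) fun i _ => hG _ _
    rw [Finset.sum_const, Finset.card_univ, Fintype.card_fin, smul_eq_mul, mul_one] at h1
    have hs : ((Equiv.Perm.sign s : ℤ) : MvPolynomial (Fin N) (MvPolynomial (Fin N × F.dots) K)) =
        C ((Equiv.Perm.sign s : ℤ) : MvPolynomial (Fin N × F.dots) K) := by simp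
    have h2 := (isHomogeneous_C (Fin N)
      ((Equiv.Perm.sign s : ℤ) : MvPolynomial (Fin N × F.dots) K)).mul h1
    rw [zero_add, ← hs] at h2
    exact h2
  convert isZariskiOpen_no_common_zero hδ f hf using 1
  ext a
  change F.IsCodeAtLeast N δ _ ↔ _
  rw [F.isCodeAtLeast_span_iff hδ _ fun k => F.shapeMatrix_mem _]
  refine forall_congr' fun x => imp_congr_right fun _ => ?_
  rw [Matrix.le_rank_iff_exists_minor]
  refine exists_congr fun y => not_congr (Eq.congr_left ?_)
  simp only [f]
  rw [RingHom.map_det, RingHom.map_det]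
  congr 1
  ext i j
  simp only [RingHom.mapMatrix_apply, Matrix.map_apply, Matrix.submatrix_apply, G, Matrix.of_apply,
    Matrix.sum_apply, Matrix.smul_apply, shapeMatrix]
  split_ifs with h
  · rw [map_sum, map_sum]
    refine Finset.sum_congr rfl fun k _ => ?_
    simp [mul_comm]
  · simp

end FerrersDiagram

/-! ### From the algebraically closed field to its finite subfields. -/

theorem MvPolynomial.card_zeros_mul_le {σ K L : Type*} [Fintype σ] [Field K] [Finite K] [Field L]
    (i : K →+* L) {p : MvPolynomial σ L} (hp : p ≠ 0) :
    (Nat.card {x : σ → K // eval (fun s => i (x s)) p = 0} : ℝ) / Nat.card (σ → K) ≤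
      p.totalDegree / Nat.card K := by
  classical
  have := Fintype.ofFinite K
  let e := Fintype.equivFin σ
  let S : Finset L := Finset.univ.map ⟨i, i.injective⟩
  have hS : S.card = Nat.card K := by
    rw [Finset.card_map, Finset.card_univ, Nat.card_eq_fintype_card]
  have hp' : rename e p ≠ 0 := by
    rwa [Ne, map_eq_zero_iff _ (rename_injective _ e.injective)]
  have h := schwartz_zippel_totalDegree hp' S
  have h1 : Nat.card {x : σ → K // eval (fun s => i (x s)) p = 0} ≤
      (((Fintype.piFinset fun _ : Fin (Fintype.card σ) => S).filter
        fun x => eval x (rename e p) = 0)).card := by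
    rw [← Fintype.card_coe, ← Nat.card_eq_fintype_card]
    refine Nat.card_le_card_of_injective (fun x => ⟨fun s => i (x.1 (e.symm s)), ?_⟩) ?_
    · rw [Finset.mem_filter]
      refine ⟨by simp [S], ?_⟩
      have hx : (fun s => i (x.1 (e.symm s))) ∘ e = fun s => i (x.1 s) := by
        funext s
        simp
      rw [eval_rename, hx]
      exact x.2
    · intro x y hxy
      ext s
      have := congrFun (Subtype.mk.inj hxy) (e s)
      simpa using i.injective this
  have h2 : (p.rename e).totalDegree = p.totalDegree := by
    simpa using totalDegree_renameEquiv (R := L) e p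
  rw [h2, hS] at h
  have h3 : ((((Fintype.piFinset fun _ : Fin (Fintype.card σ) => S).filter
        fun x => eval x (rename e p) = 0)).card : ℝ) / (Nat.card K : ℝ) ^ (Fintype.card σ) ≤
      p.totalDegree / Nat.card K := by
    have h4 := (NNRat.cast_le (K := ℝ)).2 h
    push_cast at h4
    exact h4
  refine le_trans ?_ h3
  rw [Nat.card_fun, Nat.card_eq_fintype_card (α := σ), Nat.cast_pow]
  gcongr

theorem Matrix.rank_map_le {m n : Type*} [Fintype m] [Fintype n] {K L : Type*} [Field K] [Field L]
    (i : K →+* L) (B : Matrix m n K) : (B.map i).rank ≤ B.rank := by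
  obtain ⟨x, hx⟩ := ((B.map i).le_rank_iff_exists_minor _).1 le_rfl
  refine (B.le_rank_iff_exists_minor _).2 ⟨x, fun h0 => hx ?_⟩
  have := i.map_det (B.submatrix x.1 x.2)
  rw [h0, map_zero] at this
  exact this.symm

namespace FerrersDiagram

variable {m n : ℕ}

/-- Take a nonzero polynomial `p` over `L` vanishing off the locus. A bad tuple over `K` stays bad
over `L`, so it is a zero of `p`; Schwartz-Zippel counts these, and `D = p.totalDegree` does not
depend on `K`. -/
theorem exists_sub_le_spanProb (F : FerrersDiagram m n) {N r : ℕ} {L : Type*} [Field L]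
    (hne : (F.spanLocus N L (F.IsCodeAtLeast N (r + 1))).Nonempty)
    (hU : IsZariskiOpen (F.spanLocus N L (F.IsCodeAtLeast N (r + 1)))) :
    ∃ D : ℕ, ∀ (K : Type) [Field K] [Finite K] (_ : K →+* L),
      1 - (D : ℝ) / Nat.card K ≤ F.spanProb N K (F.IsCodeAtLeast N (r + 1)) := by
  obtain ⟨I, hI⟩ := hU
  obtain ⟨a, ha⟩ := hne
  rw [hI] at ha
  obtain ⟨p, hpI, hp⟩ : ∃ p ∈ I, MvPolynomial.aeval a p ≠ 0 := by
    by_contra! h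
    exact ha h
  have hp0 : p ≠ 0 := fun h => hp (by rw [h, map_zero])
  refine ⟨p.totalDegree, fun K _ _ i => ?_⟩
  rw [spanProb_eq]
  have h1 := MvPolynomial.card_zeros_mul_le i hp0
  have h2 : Nat.card (hitting N K (F.lowRank r K)) ≤
      Nat.card {x : Fin N × F.dots → K // MvPolynomial.eval (fun s => i (x s)) p = 0} := by
    refine Nat.card_le_card_of_injective
      (fun A => ⟨fun s => (F.shapeEquiv K).symm (A.1 s.1) s.2, ?_⟩) ?_
    · by_contra hne
      have hmem : (fun s : Fin N × F.dots => i ((F.shapeEquiv K).symm (A.1 s.1) s.2)) ∈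
          F.spanLocus N L (F.IsCodeAtLeast N (r + 1)) := by
        rw [hI]
        intro hz
        exact hne (by simpa [MvPolynomial.aeval_eq_eval] using hz p hpI)
      change F.IsCodeAtLeast N (r + 1) _ at hmem
      rw [F.isCodeAtLeast_span_iff (by omega) _ fun k => F.shapeMatrix_mem _] at hmem
      obtain ⟨x, hx, hxA⟩ := A.2
      have h3 := hmem (fun k => i (x k)) fun h => hx (funext fun k => i.injective (by
        rw [Pi.zero_apply, map_zero]; exact congrFun h k))
      have h4 : ∑ k, i (x k) • (F.shapeMatrix fun s =>
          i ((F.shapeEquiv K).symm (A.1 k) s)) = (tupleComb (F.shapeSpace K) x A.1).1.map i := by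
        rw [coe_tupleComb]
        ext a b
        simp only [Matrix.sum_apply, Matrix.smul_apply, Matrix.map_apply, map_sum, smul_eq_mul,
          map_mul]
        refine Finset.sum_congr rfl fun k _ => ?_
        congr 1
        have h5 : (A.1 k).1 = F.shapeMatrix ((F.shapeEquiv K).symm (A.1 k)) :=
          congrArg Subtype.val ((F.shapeEquiv K).apply_symm_apply (A.1 k)).symm
        rw [h5]
        simp only [shapeMatrix, Matrix.of_apply]
        split_ifs <;> simp
      rw [h4] at h3
      have h6 : (tupleComb (F.shapeSpace K) x A.1).1.rank ≤ r := hxA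
      have := Matrix.rank_map_le i (tupleComb (F.shapeSpace K) x A.1).1
      omega
    · intro A B hAB
      refine Subtype.ext (funext fun k => (F.shapeEquiv K).symm.injective (funext fun s => ?_))
      exact congrFun (Subtype.mk.inj hAB) (k, s)
  have h3 : Nat.card (Fin N × F.dots → K) = Nat.card (Fin N → F.shapeSpace K) := by
    refine Nat.card_congr ((Equiv.curry _ _ _).trans (Equiv.piCongrRight fun _ =>
      (F.shapeEquiv K).toEquiv))
  rw [h3] at h1
  have h4 : (Nat.card (hitting N K (F.lowRank r K)) : ℝ) / Nat.card (Fin N → F.shapeSpace K) ≤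
      p.totalDegree / Nat.card K := by
    refine le_trans ?_ h1
    gcongr
  linarith

theorem nonempty_galoisField_ringHom (L : Type*) [Field L] [IsAlgClosed L] (p : ℕ) [Fact p.Prime]
    [CharP L p] (k : ℕ) : Nonempty (GaloisField p k →+* L) := by
  let := ZMod.algebra L p
  exact ⟨(IsAlgClosed.lift : GaloisField p k →ₐ[ZMod p] L).toRingHom⟩

theorem spanLocus_nonempty_of_exists (F : FerrersDiagram m n) {N : ℕ} {L : Type*} [Field L]
    (P : Submodule L (Matrix (Fin m) (Fin n) L) → Prop)
    (h : ∃ A : Fin N → F.shapeSpace L, P (Submodule.span L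
      (Set.range fun k => (A k : Matrix (Fin m) (Fin n) L)))) : (F.spanLocus N L P).Nonempty := by
  obtain ⟨A, hA⟩ := h
  refine ⟨fun s => (F.shapeEquiv L).symm (A s.1) s.2, ?_⟩
  change P _
  convert hA using 4 with k
  exact congrArg Subtype.val ((F.shapeEquiv L).apply_symm_apply (A k))

theorem exists_of_spanLocus_nonempty (F : FerrersDiagram m n) {N : ℕ} {L : Type*} [Field L]
    (P : Submodule L (Matrix (Fin m) (Fin n) L) → Prop) (h : (F.spanLocus N L P).Nonempty) :
    ∃ A : Fin N → F.shapeSpace L, P (Submodule.span L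
      (Set.range fun k => (A k : Matrix (Fin m) (Fin n) L))) := by
  obtain ⟨a, ha⟩ := h
  exact ⟨fun k => F.shapeEquiv L fun x => a (k, x), ha⟩

theorem add_rankDim_le_of_exists (F : FerrersDiagram m n) {N r : ℕ} (L : Type*) [Field L]
    [IsAlgClosed L] (p : ℕ) [Fact p.Prime] [CharP L p]
    (h : ∃ A : Fin N → F.shapeSpace L, F.IsCodeAtLeast N (r + 1) (Submodule.span L
      (Set.range fun k => (A k : Matrix (Fin m) (Fin n) L)))) :
    N + F.rankDim r ≤ F.dots.card := by
  by_contra! hlt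
  obtain ⟨D, hD⟩ := F.exists_sub_le_spanProb (F.spanLocus_nonempty_of_exists _ h)
    (F.isZariskiOpen_spanLocus (by omega) L)
  -- The exponent makes the field have more than `3 * D` elements, so that `1 - D / q` exceeds `2 /
  -- 3`.
  obtain ⟨i⟩ := nonempty_galoisField_ringHom L p (3 * D + 1)
  have h1 := hD (GaloisField p (3 * D + 1)) i
  have h2 := F.spanProb_le hlt (GaloisField p (3 * D + 1))
  rw [GaloisField.card p _ (by omega)] at h1
  have h3 : 3 * D + 1 < p ^ (3 * D + 1) := Nat.lt_pow_self (Fact.out : p.Prime).one_lt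
  have h4 : (3 * D + 1 : ℝ) < (p ^ (3 * D + 1) : ℕ) := by exact_mod_cast h3
  have h5 : (D : ℝ) / (p ^ (3 * D + 1) : ℕ) < 1 / 3 := by
    rw [div_lt_iff₀ (by linarith [(Nat.cast_nonneg D : (0 : ℝ) ≤ D)])]
    linarith
  linarith

theorem exists_span_isCodeAtLeast (F : FerrersDiagram m n) {N r : ℕ}
    (h : N + F.rankDim r ≤ F.dots.card) (K : Type*) [Field K] [Infinite K] :
    ∃ A : Fin N → F.shapeSpace K, F.IsCodeAtLeast N (r + 1) (Submodule.span K
      (Set.range fun k => (A k : Matrix (Fin m) (Fin n) K))) := by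
  obtain ⟨A, hA⟩ := F.exists_code h K
  exact ⟨A, (F.isCodeAtLeast_span_iff (by omega) _ fun k => (A k).2).2 hA⟩

theorem tendsto_one_sub_div {ι : Type*} {l : Filter ι} {u : ι → ℝ} (hu : Tendsto u l atTop)
    (c : ℝ) : Tendsto (fun x => 1 - c / (u x - 1)) l (𝓝 1) := by
  have h : Tendsto (fun x => c / (u x - 1)) l (𝓝 0) :=
    (tendsto_atTop_add_const_right l (-1) hu).const_div_atTop c
  simpa using h.const_sub 1

theorem tendsto_spanProb_iff (F : FerrersDiagram m n) {N r : ℕ} (p e : ℕ) [Fact p.Prime]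
    (he : 0 < e) :
    Tendsto (fun k : ℕ => F.spanProb N (GaloisField p (e * k)) (F.IsCodeAtLeast N (r + 1)))
      atTop (𝓝 1) ↔ N + F.rankDim r ≤ F.dots.card := by
  constructor
  · intro h
    by_contra! hlt
    have := le_of_tendsto' h fun k => F.spanProb_le hlt (GaloisField p (e * k))
    norm_num at this
  · intro h
    have hp : (1 : ℝ) < p := by exact_mod_cast (Fact.out : p.Prime).one_lt
    have hu : Tendsto (fun k : ℕ => (p : ℝ) ^ (e * k)) atTop atTop :=
      (tendsto_pow_atTop_atTop_of_one_lt hp).comp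
        (tendsto_id.const_mul_atTop' he)
    refine tendsto_of_tendsto_of_tendsto_of_le_of_le' (tendsto_one_sub_div hu (2 ^ m))
      tendsto_const_nhds ?_ (Eventually.of_forall fun k => F.spanProb_le_one _ _ _)
    -- At `k = 0` the cardinality formula for `GaloisField` is not available.
    filter_upwards [eventually_gt_atTop 0] with k hk
    have := F.le_spanProb h (GaloisField p (e * k))
    rwa [GaloisField.card p _ (Nat.mul_pos he hk).ne', Nat.cast_pow] at this

end FerrersDiagram

/-! ### From tuples to subspaces, and genericity. -/

namespace FerrersDiagram

variable {m n : ℕ}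

/-- The number of ordered bases of `K ^ N`. -/
noncomputable def frameCard (N : ℕ) (K : Type*) [Field K] : ℕ :=
  Nat.card {v : Fin N → (Fin N → K) // Submodule.span K (Set.range v) = ⊤}

theorem frameCard_pos (N : ℕ) (K : Type*) [Field K] [Finite K] : 0 < frameCard N K := by
  have : Nonempty {v : Fin N → (Fin N → K) // Submodule.span K (Set.range v) = ⊤} :=
    ⟨⟨Pi.basisFun K (Fin N), (Pi.basisFun K (Fin N)).span_eq⟩⟩
  exact Nat.card_pos

theorem card_span_eq (F : FerrersDiagram m n) {N : ℕ} {K : Type*} [Field K]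
    (C : Submodule K (Matrix (Fin m) (Fin n) K)) (hC : C ≤ F.shapeSpace K)
    (hN : Module.finrank K C = N) :
    Nat.card {A : Fin N → F.shapeSpace K // Submodule.span K
      (Set.range fun k => (A k : Matrix (Fin m) (Fin n) K)) = C} = frameCard N K := by
  let b := Module.finBasisOfFinrankEq K C hN
  let ψ : (Fin N → K) →ₗ[K] Matrix (Fin m) (Fin n) K := C.subtype ∘ₗ b.equivFun.symm.toLinearMap
  have hψ : Function.Injective ψ := C.injective_subtype.comp b.equivFun.symm.injective
  have hr : LinearMap.range ψ = C := by
    rw [LinearMap.range_comp_of_range_eq_top _ (LinearEquiv.range _), Submodule.range_subtype]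
  have hspan : ∀ v : Fin N → (Fin N → K), Submodule.span K (Set.range fun k => ψ (v k)) =
      (Submodule.span K (Set.range v)).map ψ := by
    intro v
    rw [Submodule.map_span, ← Set.range_comp]
    rfl
  refine (Nat.card_congr (Equiv.ofBijective
    (fun v : {v : Fin N → (Fin N → K) // Submodule.span K (Set.range v) = ⊤} =>
      (⟨fun k => ⟨ψ (v.1 k), hC (hr ▸ LinearMap.mem_range_self ψ _)⟩, by
        simp only
        rw [hspan, v.2, Submodule.map_top, hr]⟩ : {A : Fin N → F.shapeSpace K // Submodule.span K
        (Set.range fun k => (A k : Matrix (Fin m) (Fin n) K)) = C})) ⟨?_, ?_⟩)).symm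
  · intro v w h
    refine Subtype.ext (funext fun k => hψ ?_)
    exact Subtype.mk.inj (congrFun (Subtype.mk.inj h) k)
  · rintro ⟨A, hA⟩
    have h1 : ∀ k, ∃ x, ψ x = (A k : Matrix (Fin m) (Fin n) K) := by
      intro k
      rw [← LinearMap.mem_range, hr, ← hA]
      exact Submodule.subset_span ⟨k, rfl⟩
    choose v hv using h1
    refine ⟨⟨v, Submodule.map_injective_of_injective hψ ?_⟩, ?_⟩
    · rw [← hspan, Submodule.map_top, hr, ← hA]
      simp only [hv]
    · exact Subtype.ext (funext fun k => Subtype.ext (hv k))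

theorem card_span_tuples (F : FerrersDiagram m n) {N : ℕ} {K : Type*} [Field K] [Finite K]
    (P : Submodule K (Matrix (Fin m) (Fin n) K) → Prop)
    (hP : ∀ C, P C → C ≤ F.shapeSpace K ∧ Module.finrank K C = N) :
    Nat.card {A : Fin N → F.shapeSpace K // P (Submodule.span K
      (Set.range fun k => (A k : Matrix (Fin m) (Fin n) K)))} =
      Nat.card {C // P C} * frameCard N K := by
  have := Fintype.ofFinite {C // P C}
  have e : (Σ C : {C // P C}, {A : Fin N → F.shapeSpace K // Submodule.span K
      (Set.range fun k => (A k : Matrix (Fin m) (Fin n) K)) = C.1}) ≃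
      {A : Fin N → F.shapeSpace K // P (Submodule.span K
        (Set.range fun k => (A k : Matrix (Fin m) (Fin n) K)))} :=
    { toFun := fun x => ⟨x.2.1, by rw [x.2.2]; exact x.1.2⟩
      invFun := fun A => ⟨⟨_, A.2⟩, ⟨A.1, rfl⟩⟩
      left_inv := by
        rintro ⟨⟨C, hC⟩, ⟨A, hA⟩⟩
        have hA' : Submodule.span K (Set.range fun k => (A k : Matrix (Fin m) (Fin n) K)) = C := hA
        subst hA'
        rfl
      right_inv := fun _ => rfl }
  rw [← Nat.card_congr e, Nat.card_sigma, Nat.card_eq_fintype_card (α := {C // P C}),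
    ← Finset.card_univ, ← smul_eq_mul, ← Finset.sum_const]
  exact Finset.sum_congr rfl fun C _ => F.card_span_eq C.1 (hP C.1 C.2).1 (hP C.1 C.2).2

theorem span_le_and_finrank_iff (F : FerrersDiagram m n) {N : ℕ} {K : Type*} [Field K]
    (A : Fin N → F.shapeSpace K) :
    (Submodule.span K (Set.range fun k => (A k : Matrix (Fin m) (Fin n) K)) ≤ F.shapeSpace K ∧
      Module.finrank K (Submodule.span K
        (Set.range fun k => (A k : Matrix (Fin m) (Fin n) K))) = N) ↔ LinearIndependent K A := by
  have h1 : Submodule.span K (Set.range fun k => (A k : Matrix (Fin m) (Fin n) K)) ≤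
      F.shapeSpace K := by
    rw [Submodule.span_le]
    rintro _ ⟨k, rfl⟩
    exact (A k).2
  rw [and_iff_right h1, ← LinearMap.linearIndependent_iff (F.shapeSpace K).subtype
    (Submodule.ker_subtype _), linearIndependent_iff_card_eq_finrank_span, Fintype.card_fin,
    eq_comm]
  rfl

/-- Every subspace of dimension `nuMin` is spanned by the same number `frameCard` of tuples, which
cancels: the proportion is a probability conditional on independence. -/
theorem maximalProportion_eq (F : FerrersDiagram m n) {δ : ℕ} (hδ : 1 ≤ δ) (hν : 0 < F.nuMin δ)
    (K : Type*) [Field K] [Finite K] :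
    F.maximalProportion δ K =
      F.spanProb (F.nuMin δ) K (F.IsCodeAtLeast (F.nuMin δ) δ) / F.indepProb (F.nuMin δ) K := by
  have h1 := F.card_span_tuples (N := F.nuMin δ) (F.IsCodeAtLeast (K := K) (F.nuMin δ) δ)
    fun C hC => ⟨hC.1, hC.2.1⟩
  have h2 := F.card_span_tuples (N := F.nuMin δ) (K := K)
    (fun C => C ≤ F.shapeSpace K ∧ Module.finrank K C = F.nuMin δ) fun C hC => hC
  simp_rw [span_le_and_finrank_iff] at h2
  have hb : ((frameCard (F.nuMin δ) K : ℕ) : ℝ) ≠ 0 := by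
    exact_mod_cast (frameCard_pos (F.nuMin δ) K).ne'
  have h0 := F.card_tuples_pos (F.nuMin δ) K
  unfold maximalProportion spanProb indepProb IsMaximalCode
  rw [div_div_div_cancel_right₀ h0.ne', h1, h2, Nat.cast_mul, Nat.cast_mul,
    mul_div_mul_right _ _ hb, F.isCode_nuMin_eq hδ hν]

theorem maximalProportion_le_one (F : FerrersDiagram m n) (δ : ℕ) (K : Type*) [Field K] [Finite K] :
    F.maximalProportion δ K ≤ 1 := by
  refine div_le_one_of_le₀ ?_ (Nat.cast_nonneg _)
  refine Nat.cast_le.2 (Nat.card_le_card_of_injective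
    (fun C => ⟨C.1, C.2.1, C.2.2.1⟩) fun C D h => Subtype.ext (Subtype.mk.inj h))

theorem spanProb_le_maximalProportion (F : FerrersDiagram m n) {δ : ℕ} (hδ : 1 ≤ δ)
    (hν : 0 < F.nuMin δ) (K : Type*) [Field K] [Finite K] :
    F.spanProb (F.nuMin δ) K (F.IsCodeAtLeast (F.nuMin δ) δ) ≤ F.maximalProportion δ K := by
  have h0 := F.card_tuples_pos (F.nuMin δ) K
  have h1 : F.spanProb (F.nuMin δ) K (F.IsCodeAtLeast (F.nuMin δ) δ) ≤
      F.indepProb (F.nuMin δ) K := by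
    unfold spanProb indepProb
    refine div_le_div_of_nonneg_right (Nat.cast_le.2 (Nat.card_le_card_of_injective
      (fun A => ⟨A.1, (F.span_le_and_finrank_iff A.1).1 ⟨A.2.1, A.2.2.1⟩⟩)
      fun C D h => Subtype.ext (Subtype.mk.inj h))) h0.le
  have h2 : 0 ≤ F.spanProb (F.nuMin δ) K (F.IsCodeAtLeast (F.nuMin δ) δ) := by
    unfold spanProb
    positivity
  rw [F.maximalProportion_eq hδ hν]
  rcases (h2.trans h1).eq_or_lt with h | h
  · rw [← h, div_zero, h]
    exact h1
  · exact le_div_self h2 h (F.indepProb_le_one _ K)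

theorem maximalProportion_le (F : FerrersDiagram m n) {r : ℕ} (hν : 0 < F.nuMin (r + 1))
    (h : F.dots.card < F.nuMin (r + 1) + F.rankDim r) (K : Type*) [Field K] [Finite K]
    (hK : 11 ≤ Nat.card K) : F.maximalProportion (r + 1) K ≤ 20 / 27 := by
  have h1 := F.spanProb_le h K
  have h2 := F.le_indepProb (F.nuMin_le_card (Nat.succ_le_succ (Nat.zero_le r))) K
  have hK' : (11 : ℝ) ≤ Nat.card K := by exact_mod_cast hK
  -- With at least `11` elements, independence has probability at least `9 / 10`, and `(2 / 3) / (9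
  -- / 10) = 20 / 27 < 1`.
  have h3 : 1 / (Nat.card K - 1 : ℝ) ≤ 1 / 10 :=
    one_div_le_one_div_of_le (by norm_num) (by linarith)
  rw [F.maximalProportion_eq (by omega) hν, div_le_iff₀ (by linarith)]
  linarith

theorem maximalCodesGeneric_iff (F : FerrersDiagram m n) {r : ℕ} (hν : 0 < F.nuMin (r + 1)) :
    F.MaximalCodesGeneric (r + 1) ↔ F.nuMin (r + 1) + F.rankDim r ≤ F.dots.card := by
  have hcard : ∀ x : Nat.Primes × ℕ+, ∀ [Fact (x.1 : ℕ).Prime],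
      Nat.card (GaloisField (x.1 : ℕ) (x.2 : ℕ)) = (x.1 : ℕ) ^ (x.2 : ℕ) := fun x _ =>
    GaloisField.card _ _ x.2.ne_zero
  constructor
  · intro h
    by_contra! hlt
    -- The powers of `2` alone already refute convergence to `1`.
    let u : ℕ → Nat.Primes × ℕ+ := fun k => (⟨2, Nat.prime_two⟩, k.succPNat)
    have hpow : Tendsto (fun k : ℕ => 2 ^ (k + 1)) atTop atTop :=
      (tendsto_pow_atTop_atTop_of_one_lt (by norm_num : 1 < 2)).comp (tendsto_add_atTop_nat 1)
    have hu : Tendsto u atTop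
        (comap (fun x : Nat.Primes × ℕ+ => (x.1 : ℕ) ^ (x.2 : ℕ)) atTop) :=
      tendsto_comap_iff.2 hpow
    have := le_of_tendsto (h.comp hu) (b := 20 / 27) (by
      filter_upwards [hpow.eventually_ge_atTop 11] with k hk
      have : Fact (u k).1.1.Prime := ⟨(u k).1.2⟩
      refine F.maximalProportion_le hν hlt _ ?_
      rw [hcard]
      exact hk)
    norm_num at this
  · intro h
    have hu : Tendsto (fun x : Nat.Primes × ℕ+ => (((x.1 : ℕ) ^ (x.2 : ℕ) : ℕ) : ℝ))
        (comap (fun x : Nat.Primes × ℕ+ => (x.1 : ℕ) ^ (x.2 : ℕ)) atTop) atTop :=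
      tendsto_natCast_atTop_atTop.comp tendsto_comap
    refine tendsto_of_tendsto_of_tendsto_of_le_of_le (tendsto_one_sub_div hu (2 ^ m))
      tendsto_const_nhds (fun x => ?_) fun x => ?_
    · have : Fact (x.1 : ℕ).Prime := ⟨x.1.2⟩
      refine le_trans ?_ (F.spanProb_le_maximalProportion (by omega) hν _)
      have := F.le_spanProb h (GaloisField (x.1 : ℕ) (x.2 : ℕ))
      rwa [hcard] at this
    · have : Fact (x.1 : ℕ).Prime := ⟨x.1.2⟩
      exact F.maximalProportion_le_one _ _

theorem tfae_isCodeAtLeast (F : FerrersDiagram m n) {N r : ℕ} (L : Type*) [Field L]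
    [IsAlgClosed L] (p e : ℕ) [Fact p.Prime] [CharP L p] (he : 0 < e) :
    List.TFAE
      [∃ A : Fin N → F.shapeSpace L,
        F.IsCodeAtLeast N (r + 1) (Submodule.span L
          (Set.range fun k => (A k : Matrix (Fin m) (Fin n) L))),
      (F.spanLocus N L (F.IsCodeAtLeast N (r + 1))).Nonempty ∧
        IsZariskiOpen (F.spanLocus N L (F.IsCodeAtLeast N (r + 1))),
      Tendsto (fun k : ℕ => F.spanProb N (GaloisField p (e * k)) (F.IsCodeAtLeast N (r + 1)))
        atTop (𝓝 1)] := by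
  rw [F.tendsto_spanProb_iff p e he]
  tfae_have 1 → 2 := fun h =>
    ⟨F.spanLocus_nonempty_of_exists _ h, F.isZariskiOpen_spanLocus (by omega) L⟩
  tfae_have 2 → 1 := fun h => F.exists_of_spanLocus_nonempty _ h.1
  tfae_have 1 → 3 := F.add_rankDim_le_of_exists L p
  tfae_have 3 → 1 := fun h => by
    have : Infinite L := IsAlgClosed.instInfinite
    exact F.exists_span_isCodeAtLeast h L
  tfae_finish

theorem exists_span_of_isCodeAtLeast (F : FerrersDiagram m n) {N δ : ℕ} {K : Type*} [Field K]
    {C : Submodule K (Matrix (Fin m) (Fin n) K)} (hC : F.IsCodeAtLeast N δ C) :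
    ∃ A : Fin N → F.shapeSpace K, F.IsCodeAtLeast N δ (Submodule.span K
      (Set.range fun k => (A k : Matrix (Fin m) (Fin n) K))) := by
  let b := Module.finBasisOfFinrankEq K C hC.2.1
  refine ⟨fun k => ⟨b k, hC.1 (b k).2⟩, ?_⟩
  have : Submodule.span K (Set.range fun k => (b k : Matrix (Fin m) (Fin n) K)) = C := by
    have h1 : (Set.range fun k => (b k : Matrix (Fin m) (Fin n) K)) = C.subtype '' Set.range b := by
      rw [← Set.range_comp]
      rfl
    rw [h1, ← Submodule.map_span, b.span_eq, Submodule.map_top, Submodule.range_subtype]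
  simp only [this]
  exact hC

/-- As the inequality does not mention the field, one field of one characteristic suffices to derive
it. -/
theorem forall_exists_isMaximalCode_iff (F : FerrersDiagram m n) {r : ℕ}
    (hν : 0 < F.nuMin (r + 1)) :
    (∀ (K : Type*) [Field K] [IsAlgClosed K] (ℓ : ℕ) [Fact ℓ.Prime] [CharP K ℓ],
      ∃ C : Submodule K (Matrix (Fin m) (Fin n) K), F.IsMaximalCode (r + 1) C) ↔
      F.nuMin (r + 1) + F.rankDim r ≤ F.dots.card := by
  constructor
  · intro h
    -- The lift places the test field in the universe over which the hypothesis quantifies.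
    let K₀ := ULift (ZMod 2)
    have : CharP (AlgebraicClosure K₀) 2 :=
      charP_of_injective_algebraMap (algebraMap K₀ (AlgebraicClosure K₀)).injective 2
    obtain ⟨C, hC⟩ := h (AlgebraicClosure K₀) 2
    exact F.add_rankDim_le_of_exists _ 2
      (F.exists_span_of_isCodeAtLeast ((F.isCode_nuMin_iff (by omega) hν C).1 hC))
  · intro h K _ _ ℓ _ _
    have : Infinite K := IsAlgClosed.instInfinite
    obtain ⟨A, hA⟩ := F.exists_span_isCodeAtLeast h K
    exact ⟨_, (F.isCode_nuMin_iff (by omega) hν _).2 hA⟩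

end FerrersDiagram

/-! ### Assembly of the main theorem. -/

theorem charP_of_algebra_of_natCard_eq {p e : ℕ} [Fact p.Prime] {Fq : Type*} [Field Fq]
    (hq : Nat.card Fq = p ^ e) (Fbar : Type*) [Field Fbar] [Algebra Fq Fbar] : CharP Fbar p := by
  have : Finite Fq := Nat.finite_of_card_ne_zero (by
    rw [hq]
    exact pow_ne_zero _ (Fact.out : p.Prime).ne_zero)
  have := Fintype.ofFinite Fq
  rw [Nat.card_eq_fintype_card] at hq
  have := charP_of_card_eq_prime_pow hq
  exact charP_of_injective_algebraMap (algebraMap Fq Fbar).injective p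

theorem mainTheorem2
    (p e : ℕ) [Fact p.Prime]
    {Fq : Type*} [Field Fq] (hq : Nat.card Fq = p ^ e)
    {Fbar : Type*} [Field Fbar] [Algebra Fq Fbar] [IsAlgClosure Fq Fbar]
    {m n : ℕ} (F : FerrersDiagram m n) (δ : ℕ) (hδ : 1 ≤ δ) (hδn : δ ≤ n)
    (hν : 0 < F.nuMin δ) :
    -- codes with rank distance at least `δ`, of any dimension `N ≤ nuMin`
    (∀ N : ℕ, N ≤ F.nuMin δ →
      List.TFAE
        [∃ A : Fin N → F.shapeSpace Fbar,
          F.IsCodeAtLeast N δ (Submodule.span Fbar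
            (Set.range fun k => (A k : Matrix (Fin m) (Fin n) Fbar))),
        (F.spanLocus N Fbar (F.IsCodeAtLeast N δ)).Nonempty ∧
          IsZariskiOpen (F.spanLocus N Fbar (F.IsCodeAtLeast N δ)),
        Tendsto
          (fun r : ℕ => F.spanProb N (GaloisField p (e * r)) (F.IsCodeAtLeast N δ))
          atTop (𝓝 1)]) ∧
    -- maximal codes, with rank distance exactly `δ`
    List.TFAE
      [∃ A : Fin (F.nuMin δ) → F.shapeSpace Fbar,
        F.IsCode (F.nuMin δ) δ (Submodule.span Fbar
          (Set.range fun k => (A k : Matrix (Fin m) (Fin n) Fbar))),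
      (F.spanLocus (F.nuMin δ) Fbar (F.IsCode (F.nuMin δ) δ)).Nonempty ∧
        IsZariskiOpen (F.spanLocus (F.nuMin δ) Fbar (F.IsCode (F.nuMin δ) δ)),
      Tendsto
        (fun r : ℕ =>
          F.spanProb (F.nuMin δ) (GaloisField p (e * r)) (F.IsCode (F.nuMin δ) δ))
        atTop (𝓝 1)] ∧
    -- genericity
    (F.MaximalCodesGeneric δ ↔
      ∀ (K : Type*) [Field K] [IsAlgClosed K] (ℓ : ℕ) [Fact ℓ.Prime] [CharP K ℓ],
        ∃ C : Submodule K (Matrix (Fin m) (Fin n) K), F.IsMaximalCode δ C) := by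
  have hFin : Finite Fq := Nat.finite_of_card_ne_zero (by
    rw [hq]
    exact pow_ne_zero _ (Fact.out : p.Prime).ne_zero)
  have he : 0 < e := by
    rcases Nat.eq_zero_or_pos e with rfl | he
    · have := Finite.one_lt_card (α := Fq)
      rw [hq, pow_zero] at this
      exact absurd this (lt_irrefl _)
    · exact he
  have hchar : CharP Fbar p := charP_of_algebra_of_natCard_eq hq Fbar
  have hclosed : IsAlgClosed Fbar := IsAlgClosure.isAlgClosed Fq
  -- The counting results speak of rank at most `r = δ - 1`.
  obtain ⟨r, rfl⟩ : ∃ r, δ = r + 1 := ⟨δ - 1, by omega⟩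
  refine ⟨fun N _ => F.tfae_isCodeAtLeast Fbar p e he, ?_, ?_⟩
  · simp only [F.isCode_nuMin_eq hδ hν]
    exact F.tfae_isCodeAtLeast Fbar p e he
  · rw [F.maximalCodesGeneric_iff hν, F.forall_exists_isMaximalCode_iff hν]
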